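/- **Setting.** Let $d\in\mathbb N=\{1,2,\dots\}$, $\beta>0$, $a>b\ge 0$, $\alpha\le 0$, $\mu\in\mathbb R$ and let $\mathrm{bc}\in\{\emptyset,\mathrm{per},\mathrm{Dir}\}$ be a boundary condition. Put $\Lambda_N=[-N,N]^d$, let $|\Lambda_N|$ be its volume, and for $k\in\mathbb N$ put $$q_k^{(\alpha)}=\frac{e^{\beta\alpha k}}{(4\pi\beta)^{d/2}k^{1+d/2}} .$$ Let $g_t(x,y)=(4\pi t)^{-d/2}e^{-|x-y|^2/(4t)}$ be the transition density of the Brownian motion $B$ in $\mathbb R^d$ with generator $\Delta$, let $g_t^{\mathrm{per}}(x,y)=\sum_{z\in\mathbb Z^d}g_t(x,y+2Nz)$ be the transition density of Brownian motion on $\Lambda_N$ regarded as the torus of side length $2N$, and let $g_t^{\mathrm{Dir}}(x,y)=\mathbb P_x(B_{[0,t]}\subset\Lambda_N;\,B_t\in dy)/dy$. Set $q_k^{\emptyset,\alpha}=q_k^{(\alpha)}$ for all $k$, and for $\mathrm{bc}\in\{\mathrm{per},\mathrm{Dir}\}$ $$q_k^{\mathrm{bc},\alpha}=\frac{e^{\beta\alpha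 k}}{k|\Lambda_N|}\int_{\Lambda_N}g_{k\beta}^{\mathrm{bc}}(x,x)\,dx\quad(k\le N),\qquad q_k^{\mathrm{bc},\alpha}=0\quad(k>N).$$ Under the reference process the numbers $\mathcal N_k$ of cycles of length $k$ in $\Lambda_N$, $k\in\mathbb N$, are independent Poisson random variables with means $|\Lambda_N|\,q_k^{\mathrm{bc},\alpha}$. Let $\nu^{\mathrm{bc}}_{N,\alpha}$ be the law on $\ell_1(\mathbb R)$ of the empirical cycle count $(\mathcal N_k/|\Lambda_N|)_{k\in\mathbb N}$. For $x\in\ell_1(\mathbb R_+)$ let $D(x)=\sum_{k\ge1}kx_k\in[0,\infty]$ and, for $m\in\mathbb R$, $$H_m^{\mathrm{HYL}}(x)=-mD(x)+\frac a2D(x)^2-\frac b2\sum_{k\ge 1}k^2x_k^2\quad\text{if } D(x)<\infty,\qquad H^{\mathrm{HYL}}_m(x)=+\infty\quad\text{if } D(x)=\infty ,$$ and put $H^{\mathrm{HYL}}_m=+\infty$ on $\ell_1(\mathbb R)\setminus\ell_1(\mathbb R_+)$. Let $H^{\mathrm{HYL}}_{m,\mathrm{l.s.c.}}$ be the lower semicontinuous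 regularisation of $H_m^{\mathrm{HYL}}$, that is, the greatest lower semicontinuous function on $\ell_1(\mathbb R)$ that is pointwise at most $H_m^{\mathrm{HYL}}$. Let $$\nu^{\mathrm{HYL}}_{N,\mu,\alpha}(dx)=\frac{e^{-\beta|\Lambda_N|H^{\mathrm{HYL}}_\mu(x)}}{Z_N^{\mathrm{HYL}}(\beta,\mu,\alpha)}\,\nu^{\mathrm{bc}}_{N,\alpha}(dx),\qquad Z_N^{\mathrm{HYL}}(\beta,\mu,\alpha)=\int e^{-\beta|\Lambda_N|H^{\mathrm{HYL}}_\mu}\,d\nu^{\mathrm{bc}}_{N,\alpha},$$ and let $I(x)=\sum_{k\ge1}\big(x_k(\log\frac{x_k}{q_k^{(0)}}-1)+q_k^{(0)}\big)\in[0,\infty]$ for $x\in\ell_1(\mathbb R_+)$ (with $0\log0=0$) and $I=+\infty$ on $\ell_1(\mathbb R)\setminus\ell_1(\mathbb R_+)$. **Theorem 1.5 (Large deviations principle for HYL-models).** For every $N\ge1$ the measures $\nu^{\mathrm{bc}}_{N,\alpha}$ and $\nu^{\mathrm{HYL}}_{N,\mu,\alpha}$ are well-defined probability measures on $\ell_1(\mathbb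 R)$. The sequence $(\nu^{\mathrm{HYL}}_{N,\mu,\alpha})_{N\ge1}$ satisfies a large deviation principle on $\ell_1(\mathbb R)$ with speed $|\Lambda_N|$ and the rate function $$I^{\mathrm{HYL}}_{\mu,\alpha}(x)=\beta H^{\mathrm{HYL}}_{\mu+\alpha,\mathrm{l.s.c.}}(x)+I(x)-\inf_{y\in\ell_1(\mathbb R)}\big\{\beta H^{\mathrm{HYL}}_{\mu+\alpha,\mathrm{l.s.c.}}(y)+I(y)\big\},$$ that is: $I^{\mathrm{HYL}}_{\mu,\alpha}\colon\ell_1(\mathbb R)\to[0,\infty]$ is lower semicontinuous with compact level sets, and $$\limsup_{N\to\infty}\frac1{|\Lambda_N|}\log\nu^{\mathrm{HYL}}_{N,\mu,\alpha}(F)\le-\inf_FI^{\mathrm{HYL}}_{\mu,\alpha},\qquad \liminf_{N\to\infty}\frac1{|\Lambda_N|}\log\nu^{\mathrm{HYL}}_{N,\mu,\alpha}(G)\ge-\inf_GI^{\mathrm{HYL}}_{\mu,\alpha}$$ for all closed $F$ and all open $G\subset\ell_1(\mathbb R)$. Moreover, for every $m\in\mathbb R$ and every $x\in\ell_1(\mathbb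 R_+)$ with $D(x)<\infty$, $$H^{\mathrm{HYL}}_{m,\mathrm{l.s.c.}}(x)=H^{\mathrm{HYL}}_m(x)-\frac{(m-aD(x))_+^2}{2(a-b)}=-\frac b2\sum_{k\ge1}k^2x_k^2+\begin{cases}-mD(x)+\frac a2D(x)^2,&D(x)\ge\frac ma,\\[2pt]-\frac b{a-b}\big(-mD(x)+\frac a2D(x)^2\big)-\frac{m^2}{2(a-b)},&D(x)<\frac ma,\end{cases}$$ while $H^{\mathrm{HYL}}_{m,\mathrm{l.s.c.}}(x)=+\infty$ for all other $x\in\ell_1(\mathbb R)$. -/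

import Mathlib

open MeasureTheory ProbabilityTheory Filter Topology
open scoped ENNReal NNReal

noncomputable section

/-! ### General notions: lower semicontinuous regularisation and large deviation principles -/

/-- The lower semicontinuous regularisation of `f`: the greatest lower semicontinuous function
which is pointwise at most `f`. -/
def lscRegularisation {X : Type*} [TopologicalSpace X] (f : X → EReal) : X → EReal :=
  fun x => sSup {t : EReal | ∃ g : X → EReal, LowerSemicontinuous g ∧ (∀ y, g y ≤ f y) ∧ t = g x}

/-- The sequence of measures `ν N` satisfies the large deviation principle with rate (speed)
`speed N` and good rate function `J`: `J` is nonnegative, lower semicontinuous, has compact level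
sets, and the upper bound for closed sets and the lower bound for open sets hold
(`log 0 = -∞` and the infimum over the empty set is `+∞`). -/
structure SatisfiesLDP {X : Type*} [TopologicalSpace X] [MeasurableSpace X]
    (ν : ℕ → Measure X) (speed : ℕ → ℝ) (J : X → EReal) : Prop where
  nonneg : ∀ x, 0 ≤ J x
  lowerSemicontinuous : LowerSemicontinuous J
  isCompact_level : ∀ c : ℝ, IsCompact {x | J x ≤ (c : EReal)}
  upper_bound : ∀ F : Set X, IsClosed F →
    limsup (fun N : ℕ => ENNReal.log (ν N F) / (speed N : EReal)) atTop ≤ -(⨅ x ∈ F, J x)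
  lower_bound : ∀ G : Set X, IsOpen G →
    -(⨅ x ∈ G, J x) ≤ liminf (fun N : ℕ => ENNReal.log (ν N G) / (speed N : EReal)) atTop

/-! ### The state space `ℓ₁(ℝ)` of sequences indexed by the cycle lengths `k = 1, 2, …` -/

/-- The Banach space `ℓ₁(ℝ)`, indexed by the positive integers. -/
abbrev EllOne : Type := lp (fun _ : ℕ+ => ℝ) 1

/-- `ℓ₁(ℝ)` carries its Borel σ-algebra. -/
instance EllOne.instMeasurableSpace : MeasurableSpace EllOne := borel EllOne

instance EllOne.instBorelSpace : BorelSpace EllOne := ⟨rfl⟩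

/-- The point of `ℓ₁(ℝ)` with given coordinates (and `0` if these are not summable). -/
def EllOne.ofFun (f : ℕ+ → ℝ) : EllOne :=
  open Classical in
  if h : Memℓp f 1 then ⟨f, h⟩ else 0

/-- `x ∈ ℓ₁(ℝ₊)`. -/
def IsNonneg (x : EllOne) : Prop := ∀ k : ℕ+, 0 ≤ x k

/-- The density `D(x) = ∑ₖ k xₖ` is finite. -/
def FiniteDensity (x : EllOne) : Prop := Summable fun k : ℕ+ => (k : ℝ) * x k

/-- The density `D(x) = ∑ₖ k xₖ`; only used for `x` with `FiniteDensity x`. -/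
def density (x : EllOne) : ℝ := ∑' k : ℕ+, (k : ℝ) * x k

/-! ### Boxes, heat kernels and cycle weights -/

/-- The three boundary conditions `∅`, `per`, `Dir`. -/
inductive BoundaryCondition
  | empty
  | periodic
  | dirichlet

/-- The box `Λ_N = [-N, N]^d`. -/
def box (d N : ℕ) : Set (EuclideanSpace ℝ (Fin d)) := {x | ∀ i, -(N : ℝ) ≤ x i ∧ x i ≤ N}

/-- The volume `|Λ_N|`. -/
def boxVolume (d N : ℕ) : ℝ := (volume (box d N)).toReal

/-- The transition density `g_t(x, y) = (4πt)^{-d/2} exp(-|x-y|²/(4t))` of Brownian motion with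
generator `Δ` on `ℝ^d`. -/
def heatKernel (d : ℕ) (t : ℝ) (x y : EuclideanSpace ℝ (Fin d)) : ℝ :=
  (4 * Real.pi * t) ^ (-(d : ℝ) / 2) * Real.exp (-(‖x - y‖ ^ 2) / (4 * t))

/-- The transition density of Brownian motion on the torus `(ℝ/Lℤ)^d`:
`∑_{z ∈ ℤ^d} g_t(x, y + L z)`. -/
def periodicHeatKernel (d : ℕ) (L t : ℝ) (x y : EuclideanSpace ℝ (Fin d)) : ℝ≥0∞ :=
  ∑' z : Fin d → ℤ,
    ENNReal.ofReal (heatKernel d t x (y + WithLp.toLp 2 (fun i => L * (z i : ℝ))))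

/-- The density `ℙ_x(B_{jt/2^n} ∈ Λ for all 0 < j < 2^n ; B_t ∈ dy) / dy` of Brownian motion
inspected at the `n`-th dyadic times of `(0, t)`, obtained from the Markov property at time `t/2`.
-/
def dyadicKilledKernel (d : ℕ) (Λ : Set (EuclideanSpace ℝ (Fin d))) :
    ℕ → ℝ → EuclideanSpace ℝ (Fin d) → EuclideanSpace ℝ (Fin d) → ℝ≥0∞
  | 0, t, x, y => ENNReal.ofReal (heatKernel d t x y)
  | n + 1, t, x, y =>
      ∫⁻ z in Λ, dyadicKilledKernel d Λ n (t / 2) x z * dyadicKilledKernel d Λ n (t / 2) z y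

/-- The density `g_t^{Dir}(x, y) = ℙ_x(B_{[0,t]} ⊂ Λ ; B_t ∈ dy) / dy` for a closed set `Λ` and
`x, y ∈ Λ`. As paths are continuous and `Λ` is closed, staying in `Λ` means being in `Λ` at all
dyadic times, so this is the decreasing limit of the dyadically inspected densities. -/
def dirichletHeatKernel (d : ℕ) (Λ : Set (EuclideanSpace ℝ (Fin d))) (t : ℝ)
    (x y : EuclideanSpace ℝ (Fin d)) : ℝ≥0∞ :=
  ⨅ n : ℕ, dyadicKilledKernel d Λ n t x y

/-- The cycle weight `q_k^{(α)} = e^{βαk} / ((4πβ)^{d/2} k^{1+d/2})`. -/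
def freeWeight (d : ℕ) (β α : ℝ) (k : ℕ+) : ℝ :=
  Real.exp (β * α * k) / ((4 * Real.pi * β) ^ ((d : ℝ) / 2) * (k : ℝ) ^ (1 + (d : ℝ) / 2))

/-- The weight of the cycles of length `k` for the boundary condition `bc` in the box `Λ_N`.
For `bc = ∅` it is `q_k^{(α)}`. For `bc ∈ {per, Dir}` it is
`e^{βαk} (k|Λ_N|)⁻¹ ∫_{Λ_N} g_{kβ}^{bc}(x, x) dx` if `k ≤ N`, and there are no cycles of length
`k > N`. In the periodic case `Λ_N` is regarded as the torus of side length `2N`. -/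
def cycleWeight (d : ℕ) (β α : ℝ) : BoundaryCondition → ℕ → ℕ+ → ℝ
  | .empty, _, k => freeWeight d β α k
  | .periodic, N, k =>
      if (k : ℕ) ≤ N then
        Real.exp (β * α * k) / (k * boxVolume d N) *
          (∫⁻ x in box d N, periodicHeatKernel d (2 * N) (k * β) x x).toReal
      else 0
  | .dirichlet, N, k =>
      if (k : ℕ) ≤ N then
        Real.exp (β * α * k) / (k * boxVolume d N) *
          (∫⁻ x in box d N, dirichletHeatKernel d (box d N) (k * β) x x).toReal
      else 0

/-! ### The reference measure -/

/-- The joint law of the cycle counts `(𝒩_k)_k` in `Λ_N` under the marked Poisson point process: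
independent Poisson variables, `𝒩_k` having mean `|Λ_N| q_k^{bc,α}`. -/
def cycleCountLaw (d : ℕ) (β α : ℝ) (bc : BoundaryCondition) (N : ℕ) : Measure (ℕ+ → ℕ) :=
  Measure.infinitePi fun k : ℕ+ =>
    poissonMeasure (Real.toNNReal (boxVolume d N * cycleWeight d β α bc N k))

/-- `ν_{N,α}^{bc}`: the law on `ℓ₁(ℝ)` of the empirical cycle count
`λ_N = (𝒩_k / |Λ_N|)_k`. -/
def referenceMeasure (d : ℕ) (β α : ℝ) (bc : BoundaryCondition) (N : ℕ) : Measure EllOne :=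
  (cycleCountLaw d β α bc N).map fun n => EllOne.ofFun fun k => (n k : ℝ) / boxVolume d N

/-- The rate function of the ideal Bose gas:
`I_α(x) = ∑ₖ xₖ (log (xₖ / q_k^{(α)}) - 1) + ∑ₖ q_k^{(α)}` for `x ∈ ℓ₁(ℝ₊)` (with `0 log 0 = 0`),
and `+∞` otherwise. The two series are added term by term, which makes every term nonnegative, so
that the sum always makes sense in `[0, ∞]`. -/
def idealRate (d : ℕ) (β α : ℝ) (x : EllOne) : ℝ≥0∞ :=
  open Classical in
  if IsNonneg x then
    ∑' k : ℕ+, ENNReal.ofReal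
      (x k * (Real.log (x k / freeWeight d β α k) - 1) + freeWeight d β α k)
  else ∞

/-! ### The HYL model -/

/-- The value of the HYL energy
`-μ ∑ₖ k xₖ + (a/2) (∑ₖ k xₖ)² - (b/2) ∑ₖ k² xₖ²` at `x ∈ ℓ₁(ℝ₊)` of finite density. -/
def hylEnergy (a b μ : ℝ) (x : EllOne) : ℝ :=
  -μ * density x + a / 2 * density x ^ 2 - b / 2 * ∑' k : ℕ+, (k : ℝ) ^ 2 * x k ^ 2

/-- The HYL Hamiltonian on `ℓ₁(ℝ₊)`. Its value is `+∞` at infinite density; it is extended by `+∞`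
to `ℓ₁(ℝ) ∖ ℓ₁(ℝ₊)`, the complement of the closed set `ℓ₁(ℝ₊)`, which changes neither the measures
nor the lower semicontinuous regularisation on `ℓ₁(ℝ₊)`. -/
def hylHamiltonian (a b μ : ℝ) (x : EllOne) : EReal :=
  open Classical in
  if IsNonneg x ∧ FiniteDensity x then (hylEnergy a b μ x : EReal) else ⊤

/-- The Boltzmann factor `exp(-β |Λ_N| H_μ(x))`, equal to `0` where `H_μ(x) = +∞`. -/
def hylBoltzmann (d : ℕ) (β a b μ : ℝ) (N : ℕ) (x : EllOne) : ℝ≥0∞ :=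
  EReal.exp (-(((β * boxVolume d N : ℝ) : EReal) * hylHamiltonian a b μ x))

/-- The partition function `Z_N^{HYL}(β, μ, α)`. -/
def hylPartition (d : ℕ) (β a b μ α : ℝ) (bc : BoundaryCondition) (N : ℕ) : ℝ≥0∞ :=
  ∫⁻ x, hylBoltzmann d β a b μ N x ∂(referenceMeasure d β α bc N)

/-- The measure `ν_{N,μ,α}^{HYL}(dx) = exp(-β |Λ_N| H_μ(x)) / Z_N · ν_{N,α}^{bc}(dx)`. -/
def hylMeasure (d : ℕ) (β a b μ α : ℝ) (bc : BoundaryCondition) (N : ℕ) : Measure EllOne :=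
  (referenceMeasure d β α bc N).withDensity fun x =>
    hylBoltzmann d β a b μ N x / hylPartition d β a b μ α bc N

/-- The functional `β H_{m,l.s.c.} + I`, where `I = I_0`. -/
def hylFunctional (d : ℕ) (β a b m : ℝ) (x : EllOne) : EReal :=
  (β : EReal) * lscRegularisation (hylHamiltonian a b m) x + (idealRate d β 0 x : EReal)

/-- The rate function
`I_{μ,α}^{HYL}(x) = β H_{μ+α,l.s.c.}(x) + I(x) - inf_y {β H_{μ+α,l.s.c.}(y) + I(y)}`. -/
def hylRate (d : ℕ) (β a b μ α : ℝ) (x : EllOne) : EReal :=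
  hylFunctional d β a b (μ + α) x - ⨅ y : EllOne, hylFunctional d β a b (μ + α) y

end

/-!
The idea of the proof.

Almost surely only finitely many cycle counts are nonzero (Borel–Cantelli), so every measure in the
statement is an explicit countable sum of point masses (`infinitePi_poissonMeasure_eq_sum`,
`referenceMeasure_eq_sum`). Tilting the Poisson weights by `e^{βαk}` shows that the HYL measure for
`(μ, α)` is the one for `(μ + α, 0)` (`exists_gibbsWeight_eq`, `hylMeasure_apply`), so only `α = 0`
has to be considered, with an unnormalised measure `gibbsMeasure`.

The regularised Hamiltonian. Write `D = ∑ k xₖ` and `S = ∑ k² xₖ²`. Putting a density `δ` into the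
single cycle length `k → ∞` moves a point by `δ / k → 0` in `ℓ₁`, but changes `(D, S)` to
`(D + δ, S + δ²)`. Minimising over `δ ≥ 0` gives `regEnergy`. Applied to the partial sums of `D` and
`S` it increases with the number of coordinates (`regEnergy_mono`), so the regularised Hamiltonian
is a supremum of continuous functions on the closed cone `ℓ₁(ℝ₊)`, hence lower semicontinuous, and
it is approached along the points `condensed x δ n`
(`lscRegularisation_hylHamiltonian`).

The large deviation principle. By `satisfiesLDP_of_local_bounds` it is enough to have local upper
bounds, exponential tightness and local lower bounds for `gibbsMeasure`. Both upper bounds are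
Chebyshev's inequality with the exponential moments of the Poisson process (`gibbsMeasure_le`), with
finitely supported tilts near a point and with tilts of order `log k` for tightness, which produce
compact sets by `isCompact_weighted`. The lower bound at a finitely supported point is the
probability of a single configuration, estimated by Stirling's formula
(`eventually_le_gibbsMeasure_finPoint`). A general point is replaced by `condensed x δ n`, whose
additional entropic cost vanishes because `q_k` decays only polynomially
(`tendsto_rateTerm_freeWeight`); this is why the regularised Hamiltonian appears in the rate
function.

The boundary conditions enter only through the facts that the cycle weights are bounded by a
constant times `q_k` and converge to `q_k` (`exists_cycleWeight_le`, `tendsto_cycleWeight`). On the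
torus the ratio is a power of a theta series with a large argument. For the Dirichlet condition the
reflection principle in the half-space of each face and a union bound over the faces
(`le_dyadicKilledKernel`) show that the killed kernel is close to the free one away from the
boundary.
-/

/-! ### Independent Poisson variables with summable means -/

section Poisson

variable {ι : Type*}

/-- The probability `exp(-∑ λ) ∏ₖ λₖ^{nₖ} / nₖ!` that independent Poisson variables of summable
means `λₖ` take the values `nₖ`, all but finitely many of which vanish. -/
noncomputable def poissonWeight (lam : ι → ℝ) (n : ι →₀ ℕ) : ℝ :=
  Real.exp (-∑' k, lam k) * n.prod fun k j => lam k ^ j / (j.factorial : ℝ)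

lemma poissonWeight_nonneg {lam : ι → ℝ} (h0 : ∀ k, 0 ≤ lam k) (n : ι →₀ ℕ) :
    0 ≤ poissonWeight lam n :=
  mul_nonneg (Real.exp_pos _).le
    (Finset.prod_nonneg fun k _ => div_nonneg (pow_nonneg (h0 k) _) (Nat.cast_nonneg _))

lemma hasProd_poissonWeight {lam : ι → ℝ} (h0 : ∀ k, 0 ≤ lam k) (hs : Summable lam)
    (n : ι →₀ ℕ) :
    HasProd (fun k => ENNReal.ofReal (Real.exp (-lam k) * lam k ^ n k / ((n k).factorial : ℝ)))
      (ENNReal.ofReal (poissonWeight lam n)) := by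
  have h1 : HasProd (fun k => Real.exp (-lam k)) (Real.exp (-∑' k, lam k)) :=
    hs.hasSum.neg.rexp
  have h2 : HasProd (fun k => lam k ^ n k / ((n k).factorial : ℝ))
      (n.prod fun k j => lam k ^ j / (j.factorial : ℝ)) :=
    hasProd_prod_of_ne_finset_one fun k hk => by simp [Finsupp.notMem_support_iff.1 hk]
  have h3 := (ENNReal.continuous_ofReal.tendsto _).comp (h1.mul h2)
  refine h3.congr fun s => ?_
  simp only [Function.comp]
  rw [ENNReal.ofReal_prod_of_nonneg]
  · simp only [mul_div_assoc]
  · intro k _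
    have := h0 k
    positivity

/-- By the Borel–Cantelli lemma almost surely only finitely many of the variables are nonzero, so
their joint law is carried by the countable set of finitely supported sequences. -/
theorem infinitePi_poissonMeasure_eq_sum [Countable ι] {lam : ι → ℝ} (h0 : ∀ k, 0 ≤ lam k)
    (hs : Summable lam) :
    Measure.infinitePi (fun k => poissonMeasure (lam k).toNNReal) =
      Measure.sum fun n : ι →₀ ℕ =>
        ENNReal.ofReal (poissonWeight lam n) • Measure.dirac (n : ι → ℕ) := by
  set P := Measure.infinitePi (fun k => poissonMeasure (lam k).toNNReal) with hP
  have hfin : ∀ᵐ x ∂P, {k | x ∈ {y : ι → ℕ | y k ≠ 0}}.Finite := by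
    apply ae_finite_setOfPred_mem
    have hk : ∀ k, P {y : ι → ℕ | y k ≠ 0} ≤ ENNReal.ofReal (lam k) := by
      intro k
      have e1 : P {y : ι → ℕ | y k ≠ 0} = poissonMeasure (lam k).toNNReal {0}ᶜ := by
        have := measurePreserving_eval_infinitePi
          (fun k => poissonMeasure (lam k).toNNReal) k
        rw [← this.measure_preimage (MeasurableSet.of_discrete.nullMeasurableSet)]
        rfl
      rw [e1, prob_compl_eq_one_sub (by measurability), poissonMeasure_singleton]
      rw [← ENNReal.ofReal_one, ← ENNReal.ofReal_sub _ (by positivity)]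
      apply ENNReal.ofReal_le_ofReal
      have := Real.add_one_le_exp (-(lam k))
      simp only [Real.coe_toNNReal _ (h0 k), pow_zero, Nat.factorial_zero, Nat.cast_one]
      linarith
    refine ne_top_of_le_ne_top ?_ (ENNReal.tsum_le_tsum hk)
    rw [← ENNReal.ofReal_tsum_of_nonneg h0 hs]
    exact ENNReal.ofReal_ne_top
  have hcarr : ∀ᵐ x ∂P, x ∈ Set.range (fun n : ι →₀ ℕ => (n : ι → ℕ)) := by
    filter_upwards [hfin] with x hx
    exact ⟨Finsupp.ofSupportFinite x hx, rfl⟩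
  ext A hA
  rw [Measure.sum_apply _ hA]
  have hA' : P A = P (A ∩ Set.range (fun n : ι →₀ ℕ => (n : ι → ℕ))) := by
    apply measure_congr
    filter_upwards [hcarr] with x hx
    apply propext
    exact ⟨fun h => ⟨h, hx⟩, fun h => h.1⟩
  have hset : A ∩ Set.range (fun n : ι →₀ ℕ => (n : ι → ℕ)) =
      ⋃ n : ι →₀ ℕ, (A ∩ {(n : ι → ℕ)}) := by
    ext x
    simp only [Set.mem_inter_iff, Set.mem_range, Set.mem_iUnion, Set.mem_singleton_iff]
    constructor
    · rintro ⟨h, n, rfl⟩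
      exact ⟨n, h, rfl⟩
    · rintro ⟨n, h, rfl⟩
      exact ⟨h, n, rfl⟩
  rw [hA', hset, measure_iUnion]
  · congr 1
    ext n
    rw [Measure.smul_apply, Measure.dirac_apply' _ hA, smul_eq_mul]
    by_cases hn : (n : ι → ℕ) ∈ A
    · rw [Set.inter_eq_self_of_subset_right (Set.singleton_subset_iff.2 hn), hP,
        Measure.infinitePi_singleton]
      simp only [poissonMeasure_singleton]
      simp only [Real.coe_toNNReal _ (h0 _), hn, Set.indicator_of_mem, Pi.one_apply, mul_one]
      exact (hasProd_poissonWeight h0 hs n).tprod_eq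
    · rw [Set.inter_singleton_eq_empty.2 hn]
      simp [hn]
  · intro n m hnm
    refine Set.disjoint_left.2 fun x hx hx' => hnm ?_
    exact DFunLike.coe_injective (hx.2.symm.trans hx'.2)
  · intro n
    exact hA.inter (measurableSet_singleton _)

theorem tsum_poissonWeight [Countable ι] {lam : ι → ℝ} (h0 : ∀ k, 0 ≤ lam k)
    (hs : Summable lam) :
    ∑' n : ι →₀ ℕ, ENNReal.ofReal (poissonWeight lam n) = 1 := by
  have h := congrArg (fun P => P Set.univ) (infinitePi_poissonMeasure_eq_sum h0 hs)
  simpa [Measure.sum_apply] using h.symm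

/-- Multiplying the means by `exp θₖ` amounts to exponential tilting of the law by `∑ θₖ nₖ`. -/
theorem poissonWeight_tilt {lam θ : ι → ℝ} (hs : Summable lam)
    (hs' : Summable fun k => lam k * Real.exp (θ k)) (n : ι →₀ ℕ) :
    poissonWeight lam n * Real.exp (n.sum fun k j => θ k * j) =
      Real.exp (∑' k, lam k * (Real.exp (θ k) - 1)) *
        poissonWeight (fun k => lam k * Real.exp (θ k)) n := by
  unfold poissonWeight
  have e1 : ∑' k, lam k * (Real.exp (θ k) - 1) =
      ∑' k, lam k * Real.exp (θ k) - ∑' k, lam k := by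
    rw [← hs'.tsum_sub hs]
    simp only [mul_sub, mul_one]
  have e2 : (n.prod fun k j => (lam k * Real.exp (θ k)) ^ j / (j.factorial : ℝ)) =
      (n.prod fun k j => lam k ^ j / (j.factorial : ℝ)) *
        Real.exp (n.sum fun k j => θ k * j) := by
    rw [Finsupp.sum, Real.exp_sum, Finsupp.prod, Finsupp.prod, ← Finset.prod_mul_distrib]
    refine Finset.prod_congr rfl fun k _ => ?_
    rw [mul_pow, mul_comm (θ k), Real.exp_nat_mul]
    ring
  rw [e1, e2, Real.exp_sub, Real.exp_neg, Real.exp_neg]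
  field_simp

/-- The exponential moments of a Poisson family. -/
theorem tsum_poissonWeight_mul_exp [Countable ι] {lam θ : ι → ℝ} (h0 : ∀ k, 0 ≤ lam k)
    (hs : Summable lam) (hs' : Summable fun k => lam k * Real.exp (θ k)) :
    ∑' n : ι →₀ ℕ, ENNReal.ofReal (poissonWeight lam n * Real.exp (n.sum fun k j => θ k * j)) =
      ENNReal.ofReal (Real.exp (∑' k, lam k * (Real.exp (θ k) - 1))) := by
  simp only [poissonWeight_tilt hs hs', ENNReal.ofReal_mul (Real.exp_pos _).le]
  rw [ENNReal.tsum_mul_left,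
    tsum_poissonWeight (fun k => mul_nonneg (h0 k) (Real.exp_pos _).le) hs', mul_one]

end Poisson

/-! ### A criterion for large deviation principles of normalised measures -/

section LDP

lemma log_div_le_of_le_exp {u : ℝ≥0∞} {s c : ℝ} (hs : 0 < s)
    (h : u ≤ ENNReal.ofReal (Real.exp (s * c))) : ENNReal.log u / (s : EReal) ≤ (c : EReal) := by
  rw [EReal.div_le_iff_le_mul (by exact_mod_cast hs) (EReal.coe_ne_top _)]
  calc ENNReal.log u ≤ ENNReal.log (ENNReal.ofReal (Real.exp (s * c))) := ENNReal.log_le_log h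
    _ = ((s * c : ℝ) : EReal) := by
      rw [ENNReal.log_ofReal_of_pos (Real.exp_pos _), Real.log_exp]
    _ = _ := by push_cast; rfl

lemma le_log_div_of_exp_le {u : ℝ≥0∞} {s c : ℝ} (hs : 0 < s)
    (h : ENNReal.ofReal (Real.exp (s * c)) ≤ u) : (c : EReal) ≤ ENNReal.log u / (s : EReal) := by
  rw [EReal.le_div_iff_mul_le (by exact_mod_cast hs) (EReal.coe_ne_top _)]
  calc (c : EReal) * s = ((s * c : ℝ) : EReal) := by push_cast; rw [mul_comm]
    _ = ENNReal.log (ENNReal.ofReal (Real.exp (s * c))) := by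
      rw [ENNReal.log_ofReal_of_pos (Real.exp_pos _), Real.log_exp]
    _ ≤ ENNReal.log u := ENNReal.log_le_log h

variable {X : Type*} [TopologicalSpace X] [MeasurableSpace X]
  {ρ ν : ℕ → Measure X} {s : ℕ → ℝ} {Φ : X → EReal}

/-- Local upper bounds and exponential tightness give the upper bound on closed sets. -/
theorem eventually_measure_closed_le (hs : Tendsto s atTop atTop)
    (hloc : ∀ x, ∀ c : ℝ, (c : EReal) < Φ x →
      ∃ U ∈ 𝓝 x, ∀ᶠ N in atTop, ρ N U ≤ ENNReal.ofReal (Real.exp (-(s N * c))))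
    (htight : ∀ c : ℝ, ∃ K, IsCompact K ∧
      ∀ᶠ N in atTop, ρ N Kᶜ ≤ ENNReal.ofReal (Real.exp (-(s N * c))))
    {F : Set X} (hF : IsClosed F) {c : ℝ} (hc : (c : EReal) < ⨅ x ∈ F, Φ x) :
    ∀ᶠ N in atTop, ρ N F ≤ ENNReal.ofReal (Real.exp (-(s N * c))) := by
  obtain ⟨c', hcc', hc'⟩ := EReal.lt_iff_exists_real_btwn.1 hc
  have hcc' : c < c' := by exact_mod_cast hcc'
  obtain ⟨K, hK, hKt⟩ := htight c'
  have hcover : ∃ M : ℕ, ∀ᶠ N in atTop,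
      ρ N (F ∩ K) ≤ M * ENNReal.ofReal (Real.exp (-(s N * c'))) := by
    refine (hK.inter_left hF).induction_on
      (p := fun A => ∃ M : ℕ, ∀ᶠ N in atTop,
        ρ N A ≤ M * ENNReal.ofReal (Real.exp (-(s N * c')))) ?_ ?_ ?_ ?_
    · exact ⟨0, by simp⟩
    · rintro A B hAB ⟨M, hM⟩
      exact ⟨M, hM.mono fun N h => (measure_mono hAB).trans h⟩
    · rintro A B ⟨M, hM⟩ ⟨M', hM'⟩
      refine ⟨M + M', ?_⟩
      filter_upwards [hM, hM'] with N h h'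
      refine (measure_union_le A B).trans ((add_le_add h h').trans (le_of_eq ?_))
      push_cast
      ring
    · intro x hx
      obtain ⟨U, hU, hUN⟩ := hloc x c' (hc'.trans_le (iInf₂_le x hx.1))
      exact ⟨U, mem_nhdsWithin_of_mem_nhds hU, 1, by simpa using hUN⟩
  obtain ⟨M, hM⟩ := hcover
  have hlarge : ∀ᶠ N in atTop, (M + 1 : ℝ) ≤ Real.exp (s N * (c' - c)) :=
    (Real.tendsto_exp_atTop.comp (hs.atTop_mul_const (sub_pos.2 hcc'))).eventually_ge_atTop _
  filter_upwards [hM, hKt, hlarge] with N h1 h2 h3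
  calc ρ N F ≤ ρ N (F ∩ K ∪ Kᶜ) := measure_mono fun x hx => by
        by_cases hxK : x ∈ K
        · exact Or.inl ⟨hx, hxK⟩
        · exact Or.inr hxK
    _ ≤ M * ENNReal.ofReal (Real.exp (-(s N * c'))) + ENNReal.ofReal (Real.exp (-(s N * c'))) :=
        (measure_union_le _ _).trans (add_le_add h1 h2)
    _ = ENNReal.ofReal ((M + 1) * Real.exp (-(s N * c'))) := by
        rw [ENNReal.ofReal_mul (by positivity), ENNReal.ofReal_add (by positivity) zero_le_one]
        simp [add_mul]
    _ ≤ ENNReal.ofReal (Real.exp (s N * (c' - c)) * Real.exp (-(s N * c'))) := by gcongr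
    _ = _ := by rw [← Real.exp_add]; congr 2; ring

/-- A large deviation principle for the normalised measures `ρ N / ρ N univ` follows from local
upper bounds, exponential tightness and local lower bounds for `ρ N`. Lower semicontinuity and
compactness of the level sets of `Φ` are consequences of these bounds. -/
theorem satisfiesLDP_of_local_bounds [T2Space X] [BorelSpace X]
    (hs : Tendsto s atTop atTop)
    (hν : ∀ᶠ N in atTop, ∀ A, MeasurableSet A → ν N A = ρ N A / ρ N Set.univ)
    (hloc : ∀ x, ∀ c : ℝ, (c : EReal) < Φ x →
      ∃ U ∈ 𝓝 x, ∀ᶠ N in atTop, ρ N U ≤ ENNReal.ofReal (Real.exp (-(s N * c))))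
    (htight : ∀ c : ℝ, ∃ K, IsCompact K ∧
      ∀ᶠ N in atTop, ρ N Kᶜ ≤ ENNReal.ofReal (Real.exp (-(s N * c))))
    (hlow : ∀ x, ∀ c : ℝ, Φ x < (c : EReal) → ∀ U ∈ 𝓝 x,
      ∀ᶠ N in atTop, ENNReal.ofReal (Real.exp (-(s N * c))) ≤ ρ N U)
    (hbdd : ∃ m : ℝ, ∀ x, (m : EReal) ≤ Φ x) (hproper : ∃ x, Φ x < ⊤) :
    SatisfiesLDP ν s (fun x => Φ x - ⨅ y, Φ y) := by
  obtain ⟨m, hm⟩ := hbdd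
  obtain ⟨x₀, hx₀⟩ := hproper
  have hspos : ∀ᶠ N in atTop, 0 < s N := hs.eventually_gt_atTop 0
  obtain ⟨i, hi⟩ : ∃ i : ℝ, (i : EReal) = ⨅ y, Φ y := by
    refine ⟨(⨅ y, Φ y).toReal, EReal.coe_toReal ?_ ?_⟩
    · exact ((iInf_le Φ x₀).trans_lt hx₀).ne
    · exact ((EReal.bot_lt_coe m).trans_le (le_iInf hm)).ne'
  rw [← hi]
  have hlt : ∀ (x : X) (t : EReal), t < Φ x - (i : EReal) ↔ t + (i : EReal) < Φ x := fun x t =>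
    EReal.lt_sub_iff_add_lt (Or.inl (EReal.coe_ne_bot _)) (Or.inl (EReal.coe_ne_top _))
  have hle : ∀ (x : X) (t : EReal), Φ x - (i : EReal) ≤ t ↔ Φ x ≤ t + (i : EReal) := fun x t => by
    simpa only [not_lt] using not_congr (hlt x t)
  have hΦ : LowerSemicontinuous Φ := by
    intro x y hy
    obtain ⟨c, hyc, hc⟩ := EReal.lt_iff_exists_real_btwn.1 hy
    obtain ⟨c', hcc', hc'⟩ := EReal.lt_iff_exists_real_btwn.1 hc
    have hcc' : c < c' := by exact_mod_cast hcc'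
    obtain ⟨U, hU, hUN⟩ := hloc x c' hc'
    filter_upwards [eventually_mem_nhds_iff.2 hU] with z hz
    by_contra hlt
    obtain ⟨N, h1, h2, h3⟩ :=
      (hspos.and (hUN.and (hlow z c ((not_lt.1 hlt).trans_lt hyc) U hz))).exists
    have h4 := (ENNReal.ofReal_le_ofReal_iff (Real.exp_pos _).le).1 (h3.trans h2)
    rw [Real.exp_le_exp] at h4
    nlinarith
  have hclosed : ∀ c : EReal, IsClosed {x | Φ x ≤ c} := fun c => by
    simpa only [Set.preimage, Set.mem_Iic] using hΦ.isClosed_preimage c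
  have hZup : ∀ ε : ℝ, 0 < ε →
      ∀ᶠ N in atTop, ρ N Set.univ ≤ ENNReal.ofReal (Real.exp (-(s N * (i - ε)))) := by
    intro ε hε
    apply eventually_measure_closed_le hs hloc htight isClosed_univ
    simp only [Set.mem_univ, iInf_pos, ← hi]
    exact_mod_cast sub_lt_self i hε
  have hZlow : ∀ ε : ℝ, 0 < ε →
      ∀ᶠ N in atTop, ENNReal.ofReal (Real.exp (-(s N * (i + ε)))) ≤ ρ N Set.univ := by
    intro ε hε
    obtain ⟨x, hx⟩ : ∃ x, Φ x < ((i + ε : ℝ) : EReal) := by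
      rw [← iInf_lt_iff, ← hi]
      exact_mod_cast lt_add_of_pos_right i hε
    exact hlow x _ hx _ univ_mem
  refine ⟨?_, ?_, ?_, ?_, ?_⟩
  · intro x
    rw [EReal.sub_nonneg (Or.inr (EReal.coe_ne_top _)) (Or.inr (EReal.coe_ne_bot _)), hi]
    exact iInf_le Φ x
  · intro x y hy
    filter_upwards [hΦ x _ ((hlt x y).1 hy)] with z hz
    exact (hlt z y).2 hz
  · intro c
    obtain ⟨K, hK, hKN⟩ := htight (c + i + 2)
    have hset : {x | Φ x - (i : EReal) ≤ (c : EReal)} = {x | Φ x ≤ ((c + i : ℝ) : EReal)} := by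
      ext x
      simp only [Set.mem_ofPred_eq, hle, EReal.coe_add]
    rw [hset]
    refine hK.of_isClosed_subset (hclosed _) fun x hx => ?_
    by_contra hxK
    have hlt' : Φ x < ((c + i + 1 : ℝ) : EReal) :=
      lt_of_le_of_lt hx (by exact_mod_cast lt_add_one (c + i))
    obtain ⟨N, h1, h2, h3⟩ := (hspos.and (hKN.and
      (hlow x _ hlt' Kᶜ (hK.isClosed.isOpen_compl.mem_nhds hxK)))).exists
    have h4 := (ENNReal.ofReal_le_ofReal_iff (Real.exp_pos _).le).1 (h3.trans h2)
    rw [Real.exp_le_exp] at h4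
    nlinarith
  · intro F hF
    refine EReal.le_of_forall_lt_iff_le.1 fun c hc => ?_
    rw [EReal.neg_lt_comm, ← EReal.coe_neg] at hc
    obtain ⟨c', hcc', hc'⟩ := EReal.lt_iff_exists_real_btwn.1 hc
    obtain ⟨c'', hcc'', hc''⟩ := EReal.lt_iff_exists_real_btwn.1 hc'
    have hcc' : -c < c' := by exact_mod_cast hcc'
    have hinf : ((c' + i : ℝ) : EReal) < ⨅ x ∈ F, Φ x := by
      have h1 : ((c' + i : ℝ) : EReal) < ((c'' + i : ℝ) : EReal) := by
        have : c' < c'' := by exact_mod_cast hcc''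
        exact_mod_cast add_lt_add_left this i
      refine h1.trans_le (le_iInf₂ fun x hx => ?_)
      have := (hlt x c'').1 (hc''.trans_le (iInf₂_le x hx))
      exact_mod_cast this.le
    refine limsup_le_of_le (h := ?_)
    filter_upwards [hspos, hν, eventually_measure_closed_le hs hloc htight hF hinf,
      hZlow (c' + c) (by linarith)] with N h0 h1 h2 h3
    apply log_div_le_of_le_exp h0
    rw [h1 F hF.measurableSet]
    calc ρ N F / ρ N Set.univ
        ≤ ENNReal.ofReal (Real.exp (-(s N * (c' + i)))) /
          ENNReal.ofReal (Real.exp (-(s N * (i + (c' + c))))) := ENNReal.div_le_div h2 h3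
      _ = ENNReal.ofReal (Real.exp (s N * c)) := by
        rw [← ENNReal.ofReal_div_of_pos (Real.exp_pos _), ← Real.exp_sub]
        congr 2
        ring
  · intro G hG
    refine EReal.ge_of_forall_gt_iff_ge.1 fun c hc => ?_
    rw [EReal.lt_neg_comm, ← EReal.coe_neg] at hc
    obtain ⟨x, hx⟩ := iInf_lt_iff.1 hc
    obtain ⟨hxG, hx⟩ := iInf_lt_iff.1 hx
    have hx' : Φ x < ((i - c : ℝ) : EReal) := by
      have h1 : Φ x - (i : EReal) < ((-c : ℝ) : EReal) := hx
      rw [EReal.sub_lt_iff (Or.inl (EReal.coe_ne_bot _)) (Or.inl (EReal.coe_ne_top _))] at h1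
      refine h1.trans_eq ?_
      norm_cast
      ring
    obtain ⟨c', hc', hcc'⟩ := EReal.lt_iff_exists_real_btwn.1 hx'
    have hcc' : c' < i - c := by exact_mod_cast hcc'
    refine le_liminf_of_le (h := ?_)
    filter_upwards [hspos, hν, hlow x c' hc' G (hG.mem_nhds hxG),
      hZup (i - c - c') (by linarith)] with N h0 h1 h2 h3
    apply le_log_div_of_exp_le h0
    rw [h1 G hG.measurableSet]
    calc ENNReal.ofReal (Real.exp (s N * c))
        = ENNReal.ofReal (Real.exp (-(s N * c'))) /
          ENNReal.ofReal (Real.exp (-(s N * (i - (i - c - c'))))) := by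
          rw [← ENNReal.ofReal_div_of_pos (Real.exp_pos _), ← Real.exp_sub]
          congr 2
          ring
      _ ≤ ρ N G / ρ N Set.univ := ENNReal.div_le_div h2 h3

end LDP

/-! ### Finitely supported points of `ℓ₁(ℝ)` -/

section FinPoint

/-- The point of `ℓ₁(ℝ)` with coordinates `f k` for `k ∈ s`, and `0` otherwise. -/
noncomputable def finPoint (s : Finset ℕ+) (f : ℕ+ → ℝ) : EllOne :=
  ∑ k ∈ s, lp.single 1 k (f k)

lemma finPoint_apply (s : Finset ℕ+) (f : ℕ+ → ℝ) (k : ℕ+) :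
    finPoint s f k = if k ∈ s then f k else 0 := by
  rw [finPoint, lp.coeFn_sum]
  exact (Finset.sum_apply k s _).trans (by simp [Pi.single_apply])

lemma continuous_finPoint (s : Finset ℕ+) : Continuous (finPoint s) :=
  continuous_finsetSum _ fun k _ => (lp.isometry_single k).continuous.comp (continuous_apply k)

lemma isNonneg_finPoint {s : Finset ℕ+} {f : ℕ+ → ℝ} (hf : ∀ k ∈ s, 0 ≤ f k) :
    IsNonneg (finPoint s f) := fun k => by
  rw [finPoint_apply]
  split_ifs with h
  exacts [hf k h, le_rfl]

lemma hasSum_comp_finPoint (s : Finset ℕ+) (f : ℕ+ → ℝ) {φ : ℕ+ → ℝ → ℝ} (hφ : ∀ k, φ k 0 = 0) :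
    HasSum (fun k => φ k (finPoint s f k)) (∑ k ∈ s, φ k (f k)) := by
  have h : ∑ k ∈ s, φ k (f k) = ∑ k ∈ s, φ k (finPoint s f k) :=
    Finset.sum_congr rfl fun k hk => by rw [finPoint_apply, if_pos hk]
  rw [h]
  exact hasSum_sum_of_ne_finset_zero fun k hk => by rw [finPoint_apply, if_neg hk, hφ]

lemma finiteDensity_finPoint (s : Finset ℕ+) (f : ℕ+ → ℝ) : FiniteDensity (finPoint s f) :=
  (hasSum_comp_finPoint s f (φ := fun k t => (k : ℝ) * t) (by simp)).summable

lemma density_finPoint (s : Finset ℕ+) (f : ℕ+ → ℝ) :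
    density (finPoint s f) = ∑ k ∈ s, (k : ℝ) * f k :=
  (hasSum_comp_finPoint s f (φ := fun k t => (k : ℝ) * t) (by simp)).tsum_eq

lemma hylEnergy_finPoint (a b m : ℝ) (s : Finset ℕ+) (f : ℕ+ → ℝ) :
    hylEnergy a b m (finPoint s f) =
      -m * ∑ k ∈ s, (k : ℝ) * f k + a / 2 * (∑ k ∈ s, (k : ℝ) * f k) ^ 2 -
        b / 2 * ∑ k ∈ s, (k : ℝ) ^ 2 * f k ^ 2 := by
  rw [hylEnergy, density_finPoint,
    (hasSum_comp_finPoint s f (φ := fun k t => (k : ℝ) ^ 2 * t ^ 2) (by simp)).tsum_eq]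

lemma continuous_coord (k : ℕ+) : Continuous fun x : EllOne => x k :=
  (continuous_apply k).comp
    (lp.uniformContinuous_coe (p := 1) (E := fun _ : ℕ+ => ℝ)).continuous

lemma isClosed_isNonneg : IsClosed {x : EllOne | IsNonneg x} := by
  simp only [IsNonneg, Set.ofPred_forall]
  exact isClosed_iInter fun k => isClosed_le continuous_const (continuous_coord k)

end FinPoint

/-! ### The lower semicontinuous regularisation of the HYL Hamiltonian -/

section Energy

/-- The regularised HYL energy as a function of the density `D = ∑ k xₖ` and of
`S = ∑ k² xₖ²`. -/
noncomputable def regEnergy (a b m D S : ℝ) : ℝ :=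
  -m * D + a / 2 * D ^ 2 - b / 2 * S - 1 / (2 * (a - b)) * max (m - a * D) 0 ^ 2

lemma continuous_regEnergy (a b m : ℝ) :
    Continuous fun p : ℝ × ℝ => regEnergy a b m p.1 p.2 := by
  unfold regEnergy
  fun_prop

/-- The regularised energy is at most the energy after adding the density `δ` in a single cycle
length `k → ∞`, which increases `S` by `δ²`. -/
lemma regEnergy_le {a b : ℝ} (hab : b < a) (m D S : ℝ) {δ : ℝ} (hδ : 0 ≤ δ) :
    regEnergy a b m D S ≤
      -m * (D + δ) + a / 2 * (D + δ) ^ 2 - b / 2 * (S + δ ^ 2) := by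
  have hab' : 0 < a - b := sub_pos.2 hab
  unfold regEnergy
  set p := max (m - a * D) 0
  have hp : m - a * D ≤ p := le_max_left _ _
  have h1 : 0 ≤ 1 / (2 * (a - b)) * ((a - b) * δ - p) ^ 2 := by positivity
  have h2 : 1 / (2 * (a - b)) * ((a - b) * δ - p) ^ 2 =
      (a - b) / 2 * δ ^ 2 - p * δ + 1 / (2 * (a - b)) * p ^ 2 := by
    field_simp
    ring
  nlinarith [mul_le_mul_of_nonneg_right hp hδ]

/-- The density that is optimally added in long cycles. -/
lemma regEnergy_eq {a b : ℝ} (hab : b < a) (m D S : ℝ) :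
    regEnergy a b m D S =
      -m * (D + max (m - a * D) 0 / (a - b)) + a / 2 * (D + max (m - a * D) 0 / (a - b)) ^ 2 -
        b / 2 * (S + (max (m - a * D) 0 / (a - b)) ^ 2) := by
  have hab' : a - b ≠ 0 := (sub_pos.2 hab).ne'
  unfold regEnergy
  rcases max_choice (m - a * D) 0 with h | h <;> rw [h]
  · field_simp
    ring
  · simp

lemma regEnergy_mono {a b : ℝ} (hb : 0 ≤ b) (hab : b < a) (m D S : ℝ) {t r : ℝ} (ht : 0 ≤ t)
    (hr : r ≤ t ^ 2) : regEnergy a b m D S ≤ regEnergy a b m (D + t) (S + r) := by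
  rw [regEnergy_eq hab m (D + t)]
  set δ := max (m - a * (D + t)) 0 / (a - b)
  have hδ : 0 ≤ δ := div_nonneg (le_max_right _ _) (sub_pos.2 hab).le
  refine (regEnergy_le hab m D S (add_nonneg ht hδ)).trans ?_
  have : b / 2 * (S + r + δ ^ 2) ≤ b / 2 * (S + (t + δ) ^ 2) := by
    refine mul_le_mul_of_nonneg_left ?_ (by linarith)
    nlinarith [mul_nonneg ht hδ]
  rw [← add_assoc]
  linarith

lemma exists_bound_of_regEnergy_le {a b : ℝ} (hb : 0 ≤ b) (hab : b < a) (m c : ℝ) :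
    ∃ B : ℝ, ∀ D S : ℝ, 0 ≤ D → S ≤ D ^ 2 → regEnergy a b m D S ≤ c → D ≤ B := by
  have hab' : 0 < a - b := sub_pos.2 hab
  have ha : 0 < a := hb.trans_lt hab
  refine ⟨max (m / a) (1 + 4 / (a - b) * (c + m ^ 2 / (a - b))), fun D S hD hS h => ?_⟩
  rcases le_total (a * D) m with h1 | h1
  · exact le_max_of_le_left ((le_div_iff₀ ha).2 (by linarith))
  · refine le_max_of_le_right ?_
    unfold regEnergy at h
    rw [max_eq_right (by linarith)] at h
    have h2 : b / 2 * S ≤ b / 2 * D ^ 2 := by gcongr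
    have h3 : 0 ≤ 1 / (a - b) * ((a - b) / 2 * D - m) ^ 2 := by positivity
    have h4 : 1 / (a - b) * ((a - b) / 2 * D - m) ^ 2 =
        (a - b) / 4 * D ^ 2 - m * D + m ^ 2 / (a - b) := by
      field_simp
      ring
    have h5 : (a - b) / 4 * D ^ 2 ≤ c + m ^ 2 / (a - b) := by linarith
    have h6 : D ^ 2 ≤ 4 / (a - b) * (c + m ^ 2 / (a - b)) := by
      calc D ^ 2 = 4 / (a - b) * ((a - b) / 4 * D ^ 2) := by field_simp
        _ ≤ _ := by gcongr
    nlinarith [sq_nonneg (D - 1)]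

lemma sum_sq_mul_sq_le {x : EllOne} (hx : IsNonneg x) (s : Finset ℕ+) :
    ∑ k ∈ s, (k : ℝ) ^ 2 * x k ^ 2 ≤ (∑ k ∈ s, (k : ℝ) * x k) ^ 2 := by
  simp only [← mul_pow]
  exact Finset.sum_sq_le_sq_sum_of_nonneg fun k _ => mul_nonneg (Nat.cast_nonneg _) (hx k)

/-- The lower semicontinuous regularisation of the HYL Hamiltonian, written as a supremum of
functions which depend on finitely many coordinates. -/
noncomputable def regHamiltonian (a b m : ℝ) (x : EllOne) : EReal :=
  open Classical in
  ⨆ s : Finset ℕ+, if IsNonneg x then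
    (regEnergy a b m (∑ k ∈ s, (k : ℝ) * x k) (∑ k ∈ s, (k : ℝ) ^ 2 * x k ^ 2) : EReal) else ⊤

lemma lowerSemicontinuous_regHamiltonian (a b m : ℝ) :
    LowerSemicontinuous (regHamiltonian a b m) := by
  classical
  refine lowerSemicontinuous_iSup fun s => ?_
  have hcont : Continuous fun x : EllOne =>
      (regEnergy a b m (∑ k ∈ s, (k : ℝ) * x k) (∑ k ∈ s, (k : ℝ) ^ 2 * x k ^ 2) : EReal) := by
    have h : Continuous fun x : EllOne =>
        (∑ k ∈ s, (k : ℝ) * x k, ∑ k ∈ s, (k : ℝ) ^ 2 * x k ^ 2) := Continuous.prodMk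
      (continuous_finsetSum _ fun k _ => continuous_const.mul (continuous_coord k))
      (continuous_finsetSum _ fun k _ => continuous_const.mul ((continuous_coord k).pow 2))
    exact continuous_coe_real_ereal.comp ((continuous_regEnergy a b m).comp h)
  intro x y hy
  by_cases hx : IsNonneg x
  · simp only [if_pos hx] at hy
    filter_upwards [hcont.tendsto x |>.eventually_const_lt hy] with z hz
    split_ifs
    · exact hz
    · exact hz.trans_le le_top
  · filter_upwards [isClosed_isNonneg.isOpen_compl.mem_nhds hx] with z hz
    simp only [if_neg hx] at hy
    rw [if_neg (show ¬ IsNonneg z from hz)]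
    exact hy

lemma regHamiltonian_of_not_isNonneg (a b m : ℝ) {x : EllOne} (hx : ¬ IsNonneg x) :
    regHamiltonian a b m x = ⊤ := by
  simp [regHamiltonian, hx]

lemma regHamiltonian_ge (a b m : ℝ) (x : EllOne) :
    (regEnergy a b m 0 0 : EReal) ≤ regHamiltonian a b m x := by
  by_cases hx : IsNonneg x
  · refine le_iSup_of_le ∅ ?_
    simp [hx]
  · rw [regHamiltonian_of_not_isNonneg a b m hx]
    exact le_top

lemma regHamiltonian_of_not_finiteDensity {a b : ℝ} (hb : 0 ≤ b) (hab : b < a) (m : ℝ)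
    {x : EllOne} (hx : ¬ FiniteDensity x) : regHamiltonian a b m x = ⊤ := by
  by_cases hn : IsNonneg x
  · refine EReal.eq_top_iff_forall_lt _ |>.2 fun c => ?_
    by_contra hc
    obtain ⟨B, hB⟩ := exists_bound_of_regEnergy_le hb hab m c
    refine hx (summable_of_sum_le (c := B) (fun k => mul_nonneg (Nat.cast_nonneg _) (hn k))
      fun s => hB _ (∑ k ∈ s, (k : ℝ) ^ 2 * x k ^ 2)
        (Finset.sum_nonneg fun k _ => mul_nonneg (Nat.cast_nonneg _) (hn k))
        (sum_sq_mul_sq_le hn s) ?_)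
    have h1 := (le_iSup (fun s : Finset ℕ+ => (regEnergy a b m (∑ k ∈ s, (k : ℝ) * x k)
      (∑ k ∈ s, (k : ℝ) ^ 2 * x k ^ 2) : EReal)) s).trans
        (by simpa only [regHamiltonian, if_pos hn, not_lt] using hc)
    exact_mod_cast h1
  · exact regHamiltonian_of_not_isNonneg a b m hn

lemma summable_sq_mul_sq {x : EllOne} (hx : IsNonneg x) (hD : FiniteDensity x) :
    Summable fun k : ℕ+ => (k : ℝ) ^ 2 * x k ^ 2 := by
  refine summable_of_sum_le (c := density x ^ 2) (fun k => by positivity) fun s =>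
    (sum_sq_mul_sq_le hx s).trans ?_
  gcongr
  · exact Finset.sum_nonneg fun k _ => mul_nonneg (Nat.cast_nonneg _) (hx k)
  · exact hD.sum_le_tsum _ fun k _ => mul_nonneg (Nat.cast_nonneg _) (hx k)

lemma regHamiltonian_eq {a b : ℝ} (hb : 0 ≤ b) (hab : b < a) (m : ℝ) {x : EllOne}
    (hx : IsNonneg x) (hD : FiniteDensity x) :
    regHamiltonian a b m x =
      (regEnergy a b m (density x) (∑' k : ℕ+, (k : ℝ) ^ 2 * x k ^ 2) : EReal) := by
  classical
  set Ds : Finset ℕ+ → ℝ := fun s => ∑ k ∈ s, (k : ℝ) * x k with hDs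
  set Ss : Finset ℕ+ → ℝ := fun s => ∑ k ∈ s, (k : ℝ) ^ 2 * x k ^ 2 with hSs
  have hmono : Monotone fun s => (regEnergy a b m (Ds s) (Ss s) : EReal) := by
    intro s t hst
    have e1 : Ds t = Ds s + Ds (t \ s) := by
      rw [add_comm]
      exact (Finset.sum_sdiff hst).symm
    have e2 : Ss t = Ss s + Ss (t \ s) := by
      rw [add_comm]
      exact (Finset.sum_sdiff hst).symm
    simp only [e1, e2, EReal.coe_le_coe_iff]
    exact regEnergy_mono hb hab m _ _
      (Finset.sum_nonneg fun k _ => mul_nonneg (Nat.cast_nonneg _) (hx k))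
      (sum_sq_mul_sq_le hx _)
  have hpair : Tendsto (fun s => (Ds s, Ss s)) atTop
      (𝓝 (density x, ∑' k : ℕ+, (k : ℝ) ^ 2 * x k ^ 2)) :=
    Tendsto.prodMk_nhds hD.hasSum (summable_sq_mul_sq hx hD).hasSum
  have h2 := (((continuous_regEnergy a b m).tendsto _).comp hpair)
  have h3 := (continuous_coe_real_ereal.tendsto _).comp h2
  have h4 : regHamiltonian a b m x = ⨆ s, (regEnergy a b m (Ds s) (Ss s) : EReal) := by
    simp only [regHamiltonian, if_pos hx, hDs, hSs]
  rw [h4]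
  exact tendsto_nhds_unique (tendsto_atTop_iSup hmono) h3

lemma regHamiltonian_le {a b : ℝ} (hb : 0 ≤ b) (hab : b < a) (m : ℝ) (x : EllOne) :
    regHamiltonian a b m x ≤ hylHamiltonian a b m x := by
  unfold hylHamiltonian
  split_ifs with h
  · rw [regHamiltonian_eq hb hab m h.1 h.2, EReal.coe_le_coe_iff]
    simpa [hylEnergy] using regEnergy_le hab m (density x) (∑' k : ℕ+, (k : ℝ) ^ 2 * x k ^ 2) le_rfl
  · exact le_top

end Energy

/-! ### The free cycle weights and the entropy of a single cycle length -/

section Rate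

/-- The contribution `t (log (t / q) - 1) + q` of one coordinate to the rate function of the ideal
gas. -/
noncomputable def rateTerm (q t : ℝ) : ℝ := t * (Real.log (t / q) - 1) + q

/-- Fenchel's inequality: `t ↦ t (log (t / q) - 1) + q` is the Legendre transform of the logarithmic
moment generating function `q (e^θ - 1)` of a Poisson variable. -/
lemma le_rateTerm {q t : ℝ} (hq : 0 < q) (ht : 0 ≤ t) (θ : ℝ) :
    θ * t - q * (Real.exp θ - 1) ≤ rateTerm q t := by
  unfold rateTerm
  rcases ht.eq_or_lt with rfl | ht
  · nlinarith [Real.exp_pos θ]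
  · have h1 := Real.add_one_le_exp (θ - Real.log (t / q))
    have h2 : t * Real.exp (θ - Real.log (t / q)) = q * Real.exp θ := by
      rw [Real.exp_sub, Real.exp_log (div_pos ht hq)]
      field_simp
    nlinarith [mul_le_mul_of_nonneg_left h1 ht.le]

lemma rateTerm_nonneg {q t : ℝ} (hq : 0 < q) (ht : 0 ≤ t) : 0 ≤ rateTerm q t := by
  simpa using le_rateTerm hq ht 0

lemma exists_lt_of_lt_rateTerm {q t c : ℝ} (hq : 0 < q) (ht : 0 ≤ t) (hc : c < rateTerm q t) :
    ∃ θ : ℝ, c < θ * t - q * (Real.exp θ - 1) := by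
  rcases ht.eq_or_lt with rfl | ht
  · -- at `t = 0` the supremum `q` over `θ` is only approached as `θ → -∞`
    have h : Tendsto (fun θ : ℝ => q * (1 - Real.exp θ)) atBot (𝓝 (q * (1 - 0))) :=
      (tendsto_const_nhds.sub Real.tendsto_exp_atBot).const_mul q
    have hc' : c < q * (1 - 0) := by simpa [rateTerm] using hc
    obtain ⟨θ, hθ⟩ := (h.eventually_const_lt hc').exists
    exact ⟨θ, by linarith⟩
  · refine ⟨Real.log (t / q), hc.trans_eq ?_⟩
    rw [Real.exp_log (div_pos ht hq), rateTerm]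
    field_simp
    ring

variable {d : ℕ} {β : ℝ}

lemma freeWeight_pos (hβ : 0 < β) (α : ℝ) (k : ℕ+) : 0 < freeWeight d β α k := by
  have : (0 : ℝ) < k := by exact_mod_cast k.pos
  unfold freeWeight
  have := Real.pi_pos
  positivity

lemma freeWeight_zero (k : ℕ+) : freeWeight d β 0 k =
    ((4 * Real.pi * β) ^ ((d : ℝ) / 2))⁻¹ * (1 / (k : ℝ) ^ (1 + (d : ℝ) / 2)) := by
  simp [freeWeight, mul_comm]

lemma summable_freeWeight_mul_rpow (hd : 1 ≤ d) {r : ℝ} (hr : r < 1 / 2) :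
    Summable fun k : ℕ+ => freeWeight d β 0 k * (k : ℝ) ^ r := by
  have hd' : (1 : ℝ) ≤ d := by exact_mod_cast hd
  have h1 : Summable fun n : ℕ => 1 / (n : ℝ) ^ (1 + (d : ℝ) / 2 - r) :=
    Real.summable_one_div_nat_rpow.2 (by linarith)
  have h2 := (h1.comp_injective PNat.coe_injective).mul_left ((4 * Real.pi * β) ^ ((d : ℝ) / 2))⁻¹
  refine h2.congr fun k => ?_
  have hk : (0 : ℝ) < k := by exact_mod_cast k.pos
  simp only [Function.comp]
  rw [freeWeight_zero, Real.rpow_sub hk]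
  field_simp

lemma summable_freeWeight (hd : 1 ≤ d) : Summable fun k : ℕ+ => freeWeight d β 0 k := by
  simpa using summable_freeWeight_mul_rpow (β := β) hd (r := 0) (by norm_num)

/-- A density `δ` carried by the single cycle length `n + 1` has asymptotically no entropic cost,
because the weights decay only polynomially. -/
lemma tendsto_rateTerm_freeWeight (hd : 1 ≤ d) (hβ : 0 < β) {δ : ℝ} (hδ : 0 ≤ δ) :
    Tendsto (fun n : ℕ => rateTerm (freeWeight d β 0 n.succPNat) (δ / (n + 1 : ℝ))) atTop
      (𝓝 0) := by
  have hq : Tendsto (fun n : ℕ => freeWeight d β 0 n.succPNat) atTop (𝓝 0) := by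
    rw [← Nat.cofinite_eq_atTop]
    exact (summable_freeWeight hd).tendsto_cofinite_zero.comp
      Nat.succPNat_injective.tendsto_cofinite
  rcases hδ.eq_or_lt with rfl | hδ
  · simpa [rateTerm] using hq
  have hC : 0 < (4 * Real.pi * β) ^ ((d : ℝ) / 2) := by
    have := Real.pi_pos
    positivity
  set C := (4 * Real.pi * β) ^ ((d : ℝ) / 2) with hCdef
  have hcast : Tendsto (fun n : ℕ => (n + 1 : ℝ)) atTop atTop :=
    tendsto_atTop_add_const_right _ _ tendsto_natCast_atTop_atTop
  have h1 : Tendsto (fun n : ℕ => δ / (n + 1 : ℝ) * (Real.log (δ * C) - 1)) atTop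
      (𝓝 (0 * (Real.log (δ * C) - 1))) :=
    (tendsto_const_nhds.div_atTop hcast).mul_const _
  have h2 : Tendsto (fun n : ℕ => (d : ℝ) / 2 * δ * (Real.log (n + 1 : ℝ) / (n + 1 : ℝ))) atTop
      (𝓝 ((d : ℝ) / 2 * δ * 0)) :=
    ((Real.isLittleO_log_id_atTop.tendsto_div_nhds_zero).comp hcast).const_mul _
  have h3 := (h1.add h2).add hq
  simp only [zero_mul, mul_zero, add_zero] at h3
  refine h3.congr fun n => ?_
  have hn : (0 : ℝ) < (n : ℝ) + 1 := by positivity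
  have e1 : δ / (n + 1 : ℝ) / freeWeight d β 0 n.succPNat =
      δ * C * (n + 1 : ℝ) ^ ((d : ℝ) / 2) := by
    rw [freeWeight_zero, ← hCdef]
    simp only [Nat.succPNat_coe, Nat.succ_eq_add_one, Nat.cast_add, Nat.cast_one]
    rw [Real.rpow_add hn, Real.rpow_one]
    field_simp
  have hx : (0 : ℝ) < (n + 1 : ℝ) ^ ((d : ℝ) / 2) := Real.rpow_pos_of_pos hn _
  rw [rateTerm, e1, Real.log_mul (mul_pos hδ hC).ne' hx.ne', Real.log_rpow hn]
  field_simp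
  ring

lemma idealRate_of_isNonneg {x : EllOne} (hx : IsNonneg x) : idealRate d β 0 x =
    ∑' k : ℕ+, ENNReal.ofReal (rateTerm (freeWeight d β 0 k) (x k)) := by
  simp [idealRate, hx, rateTerm]

end Rate

/-! ### Condensate in long cycles: recovery sequences for the regularised Hamiltonian -/

section Recovery

variable {d : ℕ} {β : ℝ}

/-- The set `{1, …, n}` of cycle lengths. -/
def firstLengths (n : ℕ) : Finset ℕ+ :=
  (Finset.range n).map ⟨Nat.succPNat, Nat.succPNat_injective⟩

lemma mem_firstLengths {n : ℕ} {k : ℕ+} : k ∈ firstLengths n ↔ (k : ℕ) ≤ n := by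
  simp only [firstLengths, Finset.mem_map, Finset.mem_range, Function.Embedding.coeFn_mk]
  constructor
  · rintro ⟨i, hi, rfl⟩
    simpa using hi
  · intro h
    exact ⟨k.natPred, by have := k.natPred_add_one; omega, k.succPNat_natPred⟩

lemma tendsto_firstLengths : Tendsto firstLengths atTop atTop :=
  tendsto_atTop_finset_of_monotone
    (fun _ _ h _ hk => mem_firstLengths.2 ((mem_firstLengths.1 hk).trans h))
    fun k => ⟨k, mem_firstLengths.2 le_rfl⟩

lemma succPNat_notMem_firstLengths (n : ℕ) : n.succPNat ∉ firstLengths n := by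
  simp [mem_firstLengths]

/-- The point which agrees with `x` at the cycle lengths `1, …, n` and carries the additional
density `δ` in the cycle length `n + 1`. -/
noncomputable def condensed (x : EllOne) (δ : ℝ) (n : ℕ) : EllOne :=
  finPoint (insert n.succPNat (firstLengths n)) (Function.update x n.succPNat (δ / (n + 1 : ℝ)))

lemma sum_condensed (x : EllOne) (δ : ℝ) (n : ℕ) {M : Type*} [AddCommMonoid M] (g : ℕ+ → ℝ → M) :
    ∑ k ∈ insert n.succPNat (firstLengths n),
      g k (Function.update x n.succPNat (δ / (n + 1 : ℝ)) k) =
      g n.succPNat (δ / (n + 1 : ℝ)) + ∑ k ∈ firstLengths n, g k (x k) := by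
  rw [Finset.sum_insert (succPNat_notMem_firstLengths n), Function.update_self]
  congr 1
  refine Finset.sum_congr rfl fun k hk => ?_
  rw [Function.update_of_ne]
  rintro rfl
  exact succPNat_notMem_firstLengths n hk

lemma tendsto_condensed (x : EllOne) (δ : ℝ) : Tendsto (condensed x δ) atTop (𝓝 x) := by
  have h1 : Tendsto (fun n => ∑ k ∈ firstLengths n, lp.single 1 k (x k)) atTop (𝓝 x) :=
    (lp.hasSum_single ENNReal.one_ne_top x).comp tendsto_firstLengths
  have h2 : Tendsto (fun n : ℕ => (lp.single 1 n.succPNat (δ / (n + 1 : ℝ)) : EllOne)) atTop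
      (𝓝 0) := by
    rw [tendsto_zero_iff_norm_tendsto_zero]
    simp only [lp.norm_single zero_lt_one]
    rw [← tendsto_zero_iff_norm_tendsto_zero]
    exact tendsto_const_nhds.div_atTop
      (tendsto_atTop_add_const_right _ _ tendsto_natCast_atTop_atTop)
  have h3 := h2.add h1
  rw [zero_add] at h3
  refine h3.congr fun n => ?_
  exact (sum_condensed x δ n (fun k t => (lp.single 1 k t : EllOne))).symm

lemma tendsto_hylEnergy_condensed (a b m : ℝ) {x : EllOne} (hx : IsNonneg x)
    (hD : FiniteDensity x) (δ : ℝ) :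
    Tendsto (fun n => hylEnergy a b m (condensed x δ n)) atTop
      (𝓝 (-m * (density x + δ) + a / 2 * (density x + δ) ^ 2 -
        b / 2 * ((∑' k : ℕ+, (k : ℝ) ^ 2 * x k ^ 2) + δ ^ 2))) := by
  have h1 : Tendsto (fun n => ∑ k ∈ firstLengths n, (k : ℝ) * x k) atTop (𝓝 (density x)) :=
    hD.hasSum.comp tendsto_firstLengths
  have h2 : Tendsto (fun n => ∑ k ∈ firstLengths n, (k : ℝ) ^ 2 * x k ^ 2) atTop
      (𝓝 (∑' k : ℕ+, (k : ℝ) ^ 2 * x k ^ 2)) :=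
    (summable_sq_mul_sq hx hD).hasSum.comp tendsto_firstLengths
  have h3 := h1.add_const δ
  have h4 := ((h3.const_mul (-m)).add ((h3.pow 2).const_mul (a / 2))).sub
    ((h2.add_const (δ ^ 2)).const_mul (b / 2))
  refine h4.congr fun n => ?_
  have hn : (n : ℝ) + 1 ≠ 0 := by positivity
  have e1 := sum_condensed x δ n (fun k t => (k : ℝ) * t)
  have e2 := sum_condensed x δ n (fun k t => (k : ℝ) ^ 2 * t ^ 2)
  rw [condensed, hylEnergy_finPoint, e1, e2]
  simp only [Nat.succPNat_coe, Nat.succ_eq_add_one, Nat.cast_add, Nat.cast_one]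
  rw [← mul_pow, mul_div_cancel₀ _ hn]
  ring

lemma update_nonneg {x : EllOne} (hx : IsNonneg x) {δ : ℝ} (hδ : 0 ≤ δ) (n : ℕ) (k : ℕ+) :
    0 ≤ Function.update x n.succPNat (δ / (n + 1 : ℝ)) k := by
  rcases eq_or_ne k n.succPNat with rfl | h
  · rw [Function.update_self]
    positivity
  · rw [Function.update_of_ne h]
    exact hx k

lemma isNonneg_condensed {x : EllOne} (hx : IsNonneg x) {δ : ℝ} (hδ : 0 ≤ δ) (n : ℕ) :
    IsNonneg (condensed x δ n) :=
  isNonneg_finPoint fun k _ => update_nonneg hx hδ n k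

lemma exists_idealRate_condensed_le (hd : 1 ≤ d) (hβ : 0 < β) {x : EllOne} (hx : IsNonneg x)
    {δ : ℝ} (hδ : 0 ≤ δ) :
    ∃ r : ℕ → ℝ≥0∞, Tendsto r atTop (𝓝 0) ∧
      ∀ n, idealRate d β 0 (condensed x δ n) ≤ idealRate d β 0 x + r n := by
  classical
  set q : ℕ+ → ℝ := fun k => freeWeight d β 0 k with hq
  refine ⟨fun n => ENNReal.ofReal (rateTerm (q n.succPNat) (δ / (n + 1 : ℝ))) +
    ∑' k : {k // k ∉ firstLengths n}, ENNReal.ofReal (q k), ?_, fun n => ?_⟩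
  · have h1 := (ENNReal.continuous_ofReal.tendsto 0).comp (tendsto_rateTerm_freeWeight hd hβ hδ)
    have h2 := (ENNReal.tendsto_tsum_compl_atTop_zero (f := fun k => ENNReal.ofReal (q k))
      (summable_freeWeight (β := β) hd).tsum_ofReal_ne_top).comp tendsto_firstLengths
    simpa using h1.add h2
  · rw [idealRate_of_isNonneg (isNonneg_condensed hx hδ n), idealRate_of_isNonneg hx]
    have h1 : ENNReal.ofReal (rateTerm (q n.succPNat) (δ / (n + 1 : ℝ))) =
        ∑' k, if k = n.succPNat then
          ENNReal.ofReal (rateTerm (q n.succPNat) (δ / (n + 1 : ℝ))) else 0 := by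
      rw [tsum_ite_eq]
    have h2 : ∑' k : {k // k ∉ firstLengths n}, ENNReal.ofReal (q k) =
        ∑' k, ({k | k ∉ firstLengths n} : Set ℕ+).indicator (fun k => ENNReal.ofReal (q k)) k :=
      tsum_subtype ({k | k ∉ firstLengths n} : Set ℕ+) (fun k => ENNReal.ofReal (q k))
    beta_reduce
    rw [h1, h2, ← ENNReal.tsum_add, ← ENNReal.tsum_add]
    refine ENNReal.tsum_le_tsum fun k => ?_
    rw [condensed, finPoint_apply]
    by_cases hk : k = n.succPNat
    · subst hk
      simp only [Finset.mem_insert_self, if_true, Function.update_self, hq]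
      exact le_add_left (le_add_right le_rfl)
    · by_cases hk' : k ∈ firstLengths n
      · rw [if_pos (Finset.mem_insert_of_mem hk'), Function.update_of_ne hk]
        exact le_add_right le_rfl
      · rw [if_neg (by simp [hk, hk']),
          Set.indicator_of_mem (show k ∈ {k | k ∉ firstLengths n} from hk')]
        refine le_add_left (le_add_left ?_)
        simp [rateTerm, hq]

/-- The regularised Hamiltonian is the greatest lower semicontinuous minorant of the Hamiltonian:
moving the optimal additional density to longer and longer cycles changes a point arbitrarily little
in `ℓ₁(ℝ)`, while its energy tends to the regularised energy. -/
theorem lscRegularisation_hylHamiltonian {a b : ℝ} (hb : 0 ≤ b) (hab : b < a) (m : ℝ)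
    (x : EllOne) :
    lscRegularisation (hylHamiltonian a b m) x = regHamiltonian a b m x := by
  refine le_antisymm (sSup_le ?_) (le_sSup ⟨regHamiltonian a b m,
    lowerSemicontinuous_regHamiltonian a b m, regHamiltonian_le hb hab m, rfl⟩)
  rintro _ ⟨g, hg, hgH, rfl⟩
  by_cases hn : IsNonneg x
  · by_cases hD : FiniteDensity x
    · rw [regHamiltonian_eq hb hab m hn hD, regEnergy_eq hab]
      set δ := max (m - a * density x) 0 / (a - b) with hδdef
      have hδ : 0 ≤ δ := div_nonneg (le_max_right _ _) (sub_pos.2 hab).le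
      refine le_of_forall_lt fun c hc => ?_
      obtain ⟨c', hcc', hc'⟩ := exists_between hc
      have h1 := (tendsto_condensed x δ).eventually (hg x c' hc')
      refine hcc'.trans_le (ge_of_tendsto ((continuous_coe_real_ereal.tendsto _).comp
        (tendsto_hylEnergy_condensed a b m hn hD δ)) (h1.mono fun n hn' => ?_))
      refine hn'.le.trans ((hgH _).trans (le_of_eq ?_))
      rw [hylHamiltonian, if_pos ⟨isNonneg_condensed hn hδ n, finiteDensity_finPoint _ _⟩]
      rfl
    · rw [regHamiltonian_of_not_finiteDensity hb hab m hD]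
      exact le_top
  · rw [regHamiltonian_of_not_isNonneg a b m hn]
    exact le_top

end Recovery

/-! ### The heat kernel killed at the boundary of a polytope -/

section Killed

variable {d : ℕ}

lemma heatKernel_nonneg {t : ℝ} (ht : 0 < t) (x y : EuclideanSpace ℝ (Fin d)) :
    0 ≤ heatKernel d t x y := by
  have := Real.pi_pos
  unfold heatKernel
  positivity

lemma heatKernel_mul_heatKernel {t : ℝ} (ht : 0 < t) (x y z : EuclideanSpace ℝ (Fin d)) :
    heatKernel d (t / 2) x z * heatKernel d (t / 2) z y =
      ((4 * Real.pi * (t / 2)) ^ (-(d : ℝ) / 2)) ^ 2 * Real.exp (-(‖x - y‖ ^ 2) / (4 * t)) *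
        Real.exp (-(1 / t) * ‖z - (2 : ℝ)⁻¹ • (x + y)‖ ^ 2) := by
  have h := parallelogram_law_with_norm ℝ (x - z) (z - y)
  have e1 : x - z + (z - y) = x - y := by abel
  have e2 : x - z - (z - y) = -((2 : ℝ) • (z - (2 : ℝ)⁻¹ • (x + y))) := by
    rw [smul_sub, smul_smul]
    norm_num
    rw [two_smul]
    abel
  rw [e1, e2, norm_neg, norm_smul, Real.norm_ofNat] at h
  unfold heatKernel
  rw [mul_mul_mul_comm, ← sq, mul_assoc (_ ^ 2), ← Real.exp_add, ← Real.exp_add]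
  congr 2
  field_simp
  linarith

lemma integrable_exp_neg_mul_norm_sq {b : ℝ} (hb : 0 < b) (m : EuclideanSpace ℝ (Fin d)) :
    Integrable fun z => Real.exp (-b * ‖z - m‖ ^ 2) := by
  have h : Integrable fun z : EuclideanSpace ℝ (Fin d) => Real.exp (-b * ‖z‖ ^ 2) := by
    refine Integrable.of_integral_ne_zero ?_
    rw [GaussianFourier.integral_rexp_neg_mul_sq_norm hb]
    have := Real.pi_pos
    positivity
  exact h.comp_sub_right m

lemma integrable_heatKernel_mul {t : ℝ} (ht : 0 < t) (x y : EuclideanSpace ℝ (Fin d)) :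
    Integrable fun z => heatKernel d (t / 2) x z * heatKernel d (t / 2) z y := by
  simp only [heatKernel_mul_heatKernel ht]
  exact (integrable_exp_neg_mul_norm_sq (by positivity) _).const_mul _

/-- The Chapman–Kolmogorov equation at the middle of the time interval. -/
lemma integral_heatKernel_mul {t : ℝ} (ht : 0 < t) (x y : EuclideanSpace ℝ (Fin d)) :
    ∫ z, heatKernel d (t / 2) x z * heatKernel d (t / 2) z y = heatKernel d t x y := by
  simp only [heatKernel_mul_heatKernel ht]
  rw [integral_const_mul, integral_sub_right_eq_self (fun z => Real.exp (-(1 / t) * ‖z‖ ^ 2)),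
    GaussianFourier.integral_rexp_neg_mul_sq_norm (by positivity)]
  have hpi := Real.pi_pos
  rw [finrank_euclideanSpace_fin, heatKernel, ← Real.rpow_natCast, ← Real.rpow_mul (by positivity),
    mul_right_comm]
  congr 1
  obtain ⟨P, hP, hPt⟩ : ∃ P, 0 < P ∧ Real.pi * t = P := ⟨_, by positivity, rfl⟩
  rw [show 4 * Real.pi * (t / 2) = 2 * (Real.pi * t) by ring,
    show 4 * Real.pi * t = 2 ^ (2 : ℝ) * (Real.pi * t) by norm_num; ring,
    show Real.pi / (1 / t) = Real.pi * t by field_simp, hPt,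
    Real.mul_rpow zero_le_two hP.le, Real.mul_rpow (by positivity) hP.le,
    ← Real.rpow_mul zero_le_two, mul_assoc, ← Real.rpow_add hP]
  congr 2 <;> push_cast <;> ring

/-- The reflection of `z` in the hyperplane `⟪e, z⟫ = c`, for a unit vector `e`. -/
noncomputable def hyperplaneReflection (e : EuclideanSpace ℝ (Fin d)) (c : ℝ) (z : EuclideanSpace ℝ (Fin d)) :
    EuclideanSpace ℝ (Fin d) :=
  z + (2 * c - 2 * inner ℝ e z) • e

variable {e : EuclideanSpace ℝ (Fin d)}

lemma measurePreserving_hyperplaneReflection (he : ‖e‖ = 1) (c : ℝ) :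
    MeasurePreserving (hyperplaneReflection e c) := by
  have h := (Measure.measurePreserving_sub_left volume ((2 * c) • e)).comp
    ((Submodule.span ℝ {e}).reflection.measurePreserving)
  have hfun : hyperplaneReflection e c =
      (fun z => (2 * c) • e - z) ∘ (Submodule.span ℝ {e}).reflection := by
    funext z
    simp only [hyperplaneReflection, Function.comp]
    rw [Submodule.reflection_singleton_apply, he, two_smul ℕ, sub_smul]
    simp only [Real.ringHom_apply, one_pow, div_one]
    rw [two_mul (inner ℝ e z), add_smul]
    abel
  rwa [hfun]

lemma inner_hyperplaneReflection (he : ‖e‖ = 1) (c : ℝ) (z : EuclideanSpace ℝ (Fin d)) :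
    inner ℝ e (hyperplaneReflection e c z) = 2 * c - inner ℝ e z := by
  rw [hyperplaneReflection, inner_add_right, inner_smul_right, real_inner_self_eq_norm_sq, he]
  ring

lemma norm_sub_hyperplaneReflection_sq (he : ‖e‖ = 1) (c : ℝ) (x y : EuclideanSpace ℝ (Fin d)) :
    ‖x - hyperplaneReflection e c y‖ ^ 2 =
      ‖x - y‖ ^ 2 + 4 * ((c - inner ℝ e x) * (c - inner ℝ e y)) := by
  rw [hyperplaneReflection, ← sub_sub, norm_sub_sq_real, inner_smul_right, norm_smul, he,
    mul_one, Real.norm_eq_abs, sq_abs, real_inner_comm e (x - y), inner_sub_right]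
  ring

lemma norm_hyperplaneReflection_sub_sq (he : ‖e‖ = 1) (c : ℝ) (x y : EuclideanSpace ℝ (Fin d)) :
    ‖hyperplaneReflection e c x - y‖ ^ 2 =
      ‖x - y‖ ^ 2 + 4 * ((c - inner ℝ e x) * (c - inner ℝ e y)) := by
  rw [norm_sub_rev, norm_sub_hyperplaneReflection_sq he, norm_sub_rev]
  ring

/-- The heat kernel reflected at the hyperplane `⟪e, z⟫ = c`. -/
noncomputable def reflectedKernel (e : EuclideanSpace ℝ (Fin d)) (c t : ℝ) (x y : EuclideanSpace ℝ (Fin d)) : ℝ :=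
  heatKernel d t x (hyperplaneReflection e c y)

lemma reflectedKernel_eq (he : ‖e‖ = 1) (c : ℝ) {t : ℝ} (ht : 0 < t)
    (x y : EuclideanSpace ℝ (Fin d)) :
    reflectedKernel e c t x y =
      heatKernel d t x y * Real.exp (-((c - inner ℝ e x) * (c - inner ℝ e y)) / t) := by
  rw [reflectedKernel, heatKernel, heatKernel, norm_sub_hyperplaneReflection_sq he,
    mul_assoc (_ ^ (_ : ℝ)), ← Real.exp_add]
  congr 2
  field_simp
  ring

lemma reflectedKernel_eq' (he : ‖e‖ = 1) (c : ℝ) (t : ℝ) (x y : EuclideanSpace ℝ (Fin d)) :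
    reflectedKernel e c t x y = heatKernel d t (hyperplaneReflection e c x) y := by
  rw [reflectedKernel, heatKernel, heatKernel, norm_sub_hyperplaneReflection_sq he,
    norm_hyperplaneReflection_sub_sq he]

lemma heatKernel_hyperplaneReflection (he : ‖e‖ = 1) (c : ℝ) (t : ℝ)
    (x y : EuclideanSpace ℝ (Fin d)) :
    heatKernel d t (hyperplaneReflection e c x) (hyperplaneReflection e c y) =
      heatKernel d t x y := by
  rw [heatKernel, heatKernel, norm_sub_hyperplaneReflection_sq he,
    norm_hyperplaneReflection_sub_sq he, inner_hyperplaneReflection he]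
  congr 4
  ring

lemma hyperplaneReflection_involutive (he : ‖e‖ = 1) (c : ℝ) (x : EuclideanSpace ℝ (Fin d)) :
    hyperplaneReflection e c (hyperplaneReflection e c x) = x := by
  conv_lhs => rw [hyperplaneReflection]
  rw [inner_hyperplaneReflection he, hyperplaneReflection, add_assoc, ← add_smul]
  ring_nf
  simp

lemma reflectedKernel_nonneg {t : ℝ} (ht : 0 < t) (c : ℝ) (x y : EuclideanSpace ℝ (Fin d)) :
    0 ≤ reflectedKernel e c t x y := heatKernel_nonneg ht _ _

lemma reflectedKernel_le (he : ‖e‖ = 1) {c t : ℝ} (ht : 0 < t) {x y : EuclideanSpace ℝ (Fin d)}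
    (hx : inner ℝ e x ≤ c) (hy : inner ℝ e y ≤ c) :
    reflectedKernel e c t x y ≤ heatKernel d t x y := by
  rw [reflectedKernel_eq he c ht]
  refine mul_le_of_le_one_right (heatKernel_nonneg ht x y) (Real.exp_le_one_iff.2 ?_)
  exact div_nonpos_of_nonpos_of_nonneg
    (neg_nonpos.2 (mul_nonneg (sub_nonneg.2 hx) (sub_nonneg.2 hy))) ht.le

/-- The product of the half-space kernels given by the reflection principle for the two halves of
the time interval, as a function of the position `z` at time `t / 2`. -/
noncomputable def halfSpaceProduct (e : EuclideanSpace ℝ (Fin d)) (c t : ℝ) (x y z : EuclideanSpace ℝ (Fin d)) :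
    ℝ :=
  (heatKernel d (t / 2) x z - reflectedKernel e c (t / 2) x z) *
    (heatKernel d (t / 2) z y - reflectedKernel e c (t / 2) z y)

lemma halfSpaceProduct_eq (he : ‖e‖ = 1) (c t : ℝ) (x y z : EuclideanSpace ℝ (Fin d)) :
    halfSpaceProduct e c t x y z =
      heatKernel d (t / 2) x z * heatKernel d (t / 2) z y -
      heatKernel d (t / 2) (hyperplaneReflection e c x) z * heatKernel d (t / 2) z y -
      heatKernel d (t / 2) x z * heatKernel d (t / 2) z (hyperplaneReflection e c y) +
      heatKernel d (t / 2) (hyperplaneReflection e c x) z *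
        heatKernel d (t / 2) z (hyperplaneReflection e c y) := by
  rw [halfSpaceProduct, reflectedKernel_eq' he, reflectedKernel]
  ring

lemma integrable_halfSpaceProduct (he : ‖e‖ = 1) (c : ℝ) {t : ℝ} (ht : 0 < t)
    (x y : EuclideanSpace ℝ (Fin d)) : Integrable (halfSpaceProduct e c t x y) := by
  have h := (((integrable_heatKernel_mul ht x y).sub
    (integrable_heatKernel_mul ht (hyperplaneReflection e c x) y)).sub
    (integrable_heatKernel_mul ht x (hyperplaneReflection e c y))).add
    (integrable_heatKernel_mul ht (hyperplaneReflection e c x) (hyperplaneReflection e c y))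
  exact h.congr (.of_forall fun z => (halfSpaceProduct_eq he c t x y z).symm)

lemma integral_halfSpaceProduct (he : ‖e‖ = 1) (c : ℝ) {t : ℝ} (ht : 0 < t)
    (x y : EuclideanSpace ℝ (Fin d)) :
    ∫ z, halfSpaceProduct e c t x y z =
      2 * (heatKernel d t x y - reflectedKernel e c t x y) := by
  have h1 := integrable_heatKernel_mul ht x y
  have h2 := integrable_heatKernel_mul ht (hyperplaneReflection e c x) y
  have h3 := integrable_heatKernel_mul ht x (hyperplaneReflection e c y)
  have h4 := integrable_heatKernel_mul ht (hyperplaneReflection e c x) (hyperplaneReflection e c y)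
  simp only [halfSpaceProduct_eq he]
  have h12 : Integrable fun z => heatKernel d (t / 2) x z * heatKernel d (t / 2) z y -
      heatKernel d (t / 2) (hyperplaneReflection e c x) z * heatKernel d (t / 2) z y := h1.sub h2
  have h123 : Integrable fun z => heatKernel d (t / 2) x z * heatKernel d (t / 2) z y -
      heatKernel d (t / 2) (hyperplaneReflection e c x) z * heatKernel d (t / 2) z y -
      heatKernel d (t / 2) x z * heatKernel d (t / 2) z (hyperplaneReflection e c y) := h12.sub h3
  rw [integral_add h123 h4, integral_sub h12 h3, integral_sub h1 h2,
    integral_heatKernel_mul ht, integral_heatKernel_mul ht, integral_heatKernel_mul ht,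
    integral_heatKernel_mul ht, heatKernel_hyperplaneReflection he, ← reflectedKernel_eq' he,
    ← reflectedKernel]
  ring

lemma halfSpaceProduct_hyperplaneReflection (he : ‖e‖ = 1) (c t : ℝ)
    (x y z : EuclideanSpace ℝ (Fin d)) :
    halfSpaceProduct e c t x y (hyperplaneReflection e c z) = halfSpaceProduct e c t x y z := by
  simp only [halfSpaceProduct, reflectedKernel, hyperplaneReflection_involutive he,
    heatKernel_hyperplaneReflection he]
  rw [← reflectedKernel_eq' he c (t / 2) z y, reflectedKernel]
  ring

lemma halfSpaceProduct_nonneg (he : ‖e‖ = 1) {c t : ℝ} (ht : 0 < t)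
    {x y z : EuclideanSpace ℝ (Fin d)} (hx : inner ℝ e x ≤ c) (hy : inner ℝ e y ≤ c)
    (hz : inner ℝ e z ≤ c) : 0 ≤ halfSpaceProduct e c t x y z :=
  mul_nonneg (sub_nonneg.2 (reflectedKernel_le he (half_pos ht) hx hz))
    (sub_nonneg.2 (reflectedKernel_le he (half_pos ht) hz hy))

lemma measurableSet_halfSpace (e : EuclideanSpace ℝ (Fin d)) (c : ℝ) :
    MeasurableSet {z : EuclideanSpace ℝ (Fin d) | inner ℝ e z ≤ c} :=
  (isClosed_le (by fun_prop) continuous_const).measurableSet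

/-- The reflection principle: the kernel `g_t(x, y) - g_t(x, Ry)` of the half-space
satisfies the Chapman–Kolmogorov inequality over that half-space. -/
lemma le_integral_indicator_halfSpaceProduct (he : ‖e‖ = 1) {c t : ℝ} (ht : 0 < t)
    {x y : EuclideanSpace ℝ (Fin d)} (hx : inner ℝ e x ≤ c) (hy : inner ℝ e y ≤ c) :
    heatKernel d t x y - reflectedKernel e c t x y ≤
      ∫ z, {z | inner ℝ e z ≤ c}.indicator (halfSpaceProduct e c t x y) z := by
  set F := {z | inner ℝ e z ≤ c}.indicator (halfSpaceProduct e c t x y) with hF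
  have hint : Integrable F :=
    (integrable_halfSpaceProduct he c ht x y).indicator (measurableSet_halfSpace e c)
  have hmp := measurePreserving_hyperplaneReflection he c
  have hint' : Integrable fun z => F (hyperplaneReflection e c z) :=
    hmp.integrable_comp_of_integrable hint
  have hcomp : ∫ z, F (hyperplaneReflection e c z) = ∫ z, F z := by
    have h := integral_map (μ := volume) (φ := hyperplaneReflection e c) hmp.measurable.aemeasurable
      (f := F) (by rw [hmp.map_eq]; exact hint.aestronglyMeasurable)
    rw [hmp.map_eq] at h
    exact h.symm
  have hF0 : ∀ z, 0 ≤ F z := fun z =>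
    Set.indicator_nonneg (fun z hz => halfSpaceProduct_nonneg he ht hx hy hz) z
  have hle : ∫ z, halfSpaceProduct e c t x y z ≤ ∫ z, (F z + F (hyperplaneReflection e c z)) := by
    refine integral_mono (integrable_halfSpaceProduct he c ht x y) (hint.add hint') fun z => ?_
    rcases le_total (inner ℝ e z) c with hz | hz
    · have : F z = halfSpaceProduct e c t x y z := Set.indicator_of_mem (s := {z | inner ℝ e z ≤ c}) hz _
      linarith [hF0 (hyperplaneReflection e c z)]
    · have hz' : inner ℝ e (hyperplaneReflection e c z) ≤ c := by
        rw [inner_hyperplaneReflection he]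
        linarith
      have : F (hyperplaneReflection e c z) = halfSpaceProduct e c t x y z :=
        (Set.indicator_of_mem (s := {z | inner ℝ e z ≤ c}) hz' _).trans
          (halfSpaceProduct_hyperplaneReflection he c t x y z)
      linarith [hF0 z]
  rw [integral_halfSpaceProduct he c ht, integral_add hint hint', hcomp] at hle
  linarith

/-- A union bound for two consecutive time intervals. Here `r i` and `r' i` bound the losses through
the `i`-th face, and the terms `p * p' - (p - r i) * (p' - r' i)` bound the loss during either
interval. -/
lemma union_bound {ι : Type*} (s : Finset ι) {p p' : ℝ} {r r' : ι → ℝ} (hp : 0 ≤ p)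
    (hp' : 0 ≤ p') (hr : ∀ i ∈ s, 0 ≤ r i) (hr' : ∀ i ∈ s, 0 ≤ r' i) (hrp : ∀ i ∈ s, r i ≤ p)
    (hrp' : ∀ i ∈ s, r' i ≤ p') :
    p * p' - ∑ i ∈ s, (p * p' - (p - r i) * (p' - r' i)) ≤
      max (p - ∑ i ∈ s, r i) 0 * max (p' - ∑ i ∈ s, r' i) 0 := by
  have e : ∑ i ∈ s, (p * p' - (p - r i) * (p' - r' i)) =
      p' * ∑ i ∈ s, r i + p * ∑ i ∈ s, r' i - ∑ i ∈ s, r i * r' i := by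
    rw [Finset.mul_sum, Finset.mul_sum, ← Finset.sum_add_distrib, ← Finset.sum_sub_distrib]
    exact Finset.sum_congr rfl fun i _ => by ring
  have h1 : ∑ i ∈ s, r i * r' i ≤ (∑ i ∈ s, r i) * ∑ i ∈ s, r' i := by
    rw [Finset.sum_mul]
    exact Finset.sum_le_sum fun i hi =>
      mul_le_mul_of_nonneg_left (Finset.single_le_sum hr' hi) (hr i hi)
  have h2 : ∑ i ∈ s, r i * r' i ≤ p * ∑ i ∈ s, r' i := by
    rw [Finset.mul_sum]
    exact Finset.sum_le_sum fun i hi => mul_le_mul_of_nonneg_right (hrp i hi) (hr' i hi)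
  have h3 : ∑ i ∈ s, r i * r' i ≤ p' * ∑ i ∈ s, r i := by
    rw [Finset.mul_sum]
    exact Finset.sum_le_sum fun i hi => by
      rw [mul_comm]
      exact mul_le_mul_of_nonneg_right (hrp' i hi) (hr i hi)
  rw [e]
  have hnn : 0 ≤ max (p - ∑ i ∈ s, r i) 0 * max (p' - ∑ i ∈ s, r' i) 0 :=
    mul_nonneg (le_max_right _ _) (le_max_right _ _)
  rcases le_total p (∑ i ∈ s, r i) with h | h
  · nlinarith [mul_le_mul_of_nonneg_left h hp']
  · rcases le_total p' (∑ i ∈ s, r' i) with h' | h'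
    · nlinarith [mul_le_mul_of_nonneg_left h' hp]
    · have := mul_nonneg (sub_nonneg.2 h) (sub_nonneg.2 h')
      rw [max_eq_left (by linarith), max_eq_left (by linarith)]
      nlinarith [h1]

lemma ofReal_max_zero (r : ℝ) : ENNReal.ofReal (max r 0) = ENNReal.ofReal r := by
  rcases le_total r 0 with h | h
  · rw [max_eq_right h, ENNReal.ofReal_zero, ENNReal.ofReal_of_nonpos h]
  · rw [max_eq_left h]

lemma ofReal_integral_le_lintegral {X : Type*} [MeasurableSpace X] {μ : Measure X} {f : X → ℝ}
    (hf : Integrable f μ) : ENNReal.ofReal (∫ x, f x ∂μ) ≤ ∫⁻ x, ENNReal.ofReal (f x) ∂μ := by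
  calc ENNReal.ofReal (∫ x, f x ∂μ) ≤ ENNReal.ofReal (∫ x, max (f x) 0 ∂μ) :=
        ENNReal.ofReal_le_ofReal (integral_mono hf hf.pos_part fun x => le_max_left _ _)
    _ = ∫⁻ x, ENNReal.ofReal (max (f x) 0) ∂μ :=
        ofReal_integral_eq_lintegral_ofReal hf.pos_part (.of_forall fun x => le_max_right _ _)
    _ = ∫⁻ x, ENNReal.ofReal (f x) ∂μ := by simp only [ofReal_max_zero]

/-- In a polytope, the kernel inspected at dyadic times is at least the free heat kernel minus the
kernels reflected at the faces. -/
theorem le_dyadicKilledKernel {ι : Type*} [Fintype ι] {e : ι → EuclideanSpace ℝ (Fin d)}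
    (he : ∀ i, ‖e i‖ = 1) {c : ℝ} {Λ : Set (EuclideanSpace ℝ (Fin d))}
    (hΛ : Λ = {z | ∀ i, inner ℝ (e i) z ≤ c}) (n : ℕ) {t : ℝ} (ht : 0 < t)
    {x y : EuclideanSpace ℝ (Fin d)} (hx : x ∈ Λ) (hy : y ∈ Λ) :
    ENNReal.ofReal (heatKernel d t x y - ∑ i, reflectedKernel (e i) c t x y) ≤
      dyadicKilledKernel d Λ n t x y := by
  have hΛm : MeasurableSet Λ := by
    rw [hΛ, Set.ofPred_forall]
    exact MeasurableSet.iInter fun i => measurableSet_halfSpace (e i) c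
  induction n generalizing t x y with
  | zero =>
    refine ENNReal.ofReal_le_ofReal (sub_le_self _ ?_)
    exact Finset.sum_nonneg fun i _ => reflectedKernel_nonneg ht c x y
  | succ n ih =>
    have ht2 := half_pos ht
    set P : EuclideanSpace ℝ (Fin d) → ℝ := fun z =>
      heatKernel d (t / 2) x z * heatKernel d (t / 2) z y with hP
    set Q : ι → EuclideanSpace ℝ (Fin d) → ℝ := fun i =>
      {z | inner ℝ (e i) z ≤ c}.indicator (halfSpaceProduct (e i) c t x y) with hQ
    have hx' : ∀ i, inner ℝ (e i) x ≤ c := by rw [hΛ] at hx; exact hx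
    have hy' : ∀ i, inner ℝ (e i) y ≤ c := by rw [hΛ] at hy; exact hy
    have hPi : Integrable P := integrable_heatKernel_mul ht x y
    have hQi : ∀ i, Integrable (Q i) := fun i =>
      (integrable_halfSpaceProduct (he i) c ht x y).indicator (measurableSet_halfSpace (e i) c)
    have hPQi : ∀ i ∈ Finset.univ, Integrable (fun z => P z - Q i z) := fun i _ =>
      hPi.sub (hQi i)
    have hG : Integrable fun z => P z - ∑ i, (P z - Q i z) :=
      hPi.sub (integrable_finsetSum _ hPQi)
    have hP0 : ∀ z, 0 ≤ P z := fun z =>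
      mul_nonneg (heatKernel_nonneg ht2 _ _) (heatKernel_nonneg ht2 _ _)
    have hQP : ∀ i z, Q i z ≤ P z := fun i z => by
      refine Set.indicator_le' (fun z hz => ?_) (fun z _ => hP0 z) z
      refine mul_le_mul (sub_le_self _ (reflectedKernel_nonneg ht2 _ _ _))
        (sub_le_self _ (reflectedKernel_nonneg ht2 _ _ _))
        (sub_nonneg.2 (reflectedKernel_le (he i) ht2 hz (hy' i))) (heatKernel_nonneg ht2 _ _)
    have hint : heatKernel d t x y - ∑ i, reflectedKernel (e i) c t x y ≤
        ∫ z, (P z - ∑ i, (P z - Q i z)) := by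
      rw [integral_sub hPi (integrable_finsetSum _ hPQi), integral_finsetSum _ hPQi,
        integral_heatKernel_mul ht]
      refine sub_le_sub_left (Finset.sum_le_sum fun i _ => ?_) _
      rw [integral_sub hPi (hQi i), integral_heatKernel_mul ht]
      linarith [le_integral_indicator_halfSpaceProduct (he i) ht (hx' i) (hy' i)]
    refine (ENNReal.ofReal_le_ofReal hint).trans ((ofReal_integral_le_lintegral hG).trans ?_)
    rw [dyadicKilledKernel, ← lintegral_indicator hΛm]
    refine lintegral_mono fun z => ?_
    by_cases hz : z ∈ Λ
    · have hz' : ∀ i, inner ℝ (e i) z ≤ c := by rw [hΛ] at hz; exact hz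
      rw [Set.indicator_of_mem hz]
      have h1 := union_bound Finset.univ (p := heatKernel d (t / 2) x z)
        (p' := heatKernel d (t / 2) z y) (r := fun i => reflectedKernel (e i) c (t / 2) x z)
        (r' := fun i => reflectedKernel (e i) c (t / 2) z y)
        (heatKernel_nonneg ht2 _ _) (heatKernel_nonneg ht2 _ _)
        (fun i _ => reflectedKernel_nonneg ht2 _ _ _) (fun i _ => reflectedKernel_nonneg ht2 _ _ _)
        (fun i _ => reflectedKernel_le (he i) ht2 (hx' i) (hz' i))
        (fun i _ => reflectedKernel_le (he i) ht2 (hz' i) (hy' i))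
      have h2 : ∀ i, Q i z = (heatKernel d (t / 2) x z - reflectedKernel (e i) c (t / 2) x z) *
          (heatKernel d (t / 2) z y - reflectedKernel (e i) c (t / 2) z y) := fun i =>
        Set.indicator_of_mem (s := {z | inner ℝ (e i) z ≤ c}) (hz' i) _
      simp only [h2, hP]
      refine (ENNReal.ofReal_le_ofReal h1).trans ?_
      rw [ENNReal.ofReal_mul (le_max_right _ _)]
      refine mul_le_mul' ?_ ?_
      · rw [ofReal_max_zero]
        exact ih ht2 hx hz
      · rw [ofReal_max_zero]
        exact ih ht2 hz hy
    · rw [Set.indicator_of_notMem hz, nonpos_iff_eq_zero, ENNReal.ofReal_eq_zero]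
      obtain ⟨i, hi⟩ : ∃ i, ¬ inner ℝ (e i) z ≤ c := by
        rw [hΛ] at hz
        exact not_forall.1 hz
      have h1 : P z - Q i z ≤ ∑ i, (P z - Q i z) :=
        Finset.single_le_sum (f := fun i => P z - Q i z) (fun i _ => sub_nonneg.2 (hQP i z))
          (Finset.mem_univ i)
      have h2 : Q i z = 0 := Set.indicator_of_notMem (s := {z | inner ℝ (e i) z ≤ c}) hi _
      linarith

/-- The outer unit normals of the box. -/
noncomputable def boxNormal (i : Fin d × Bool) : EuclideanSpace ℝ (Fin d) :=
  EuclideanSpace.single i.1 (if i.2 then 1 else -1)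

lemma norm_boxNormal (i : Fin d × Bool) : ‖boxNormal i‖ = 1 := by
  rw [boxNormal, PiLp.norm_single]
  split_ifs <;> simp

lemma inner_boxNormal (i : Fin d × Bool) (z : EuclideanSpace ℝ (Fin d)) :
    inner ℝ (boxNormal i) z = if i.2 then z i.1 else -z i.1 := by
  rw [boxNormal, EuclideanSpace.inner_single_left]
  split_ifs <;> simp

lemma box_eq (N : ℕ) : box d N = {z | ∀ i, inner ℝ (boxNormal i) z ≤ (N : ℝ)} := by
  ext z
  simp only [box, Set.mem_ofPred_eq, inner_boxNormal, Prod.forall, Bool.forall_bool]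
  refine forall_congr' fun i => ?_
  simp only [Bool.false_eq_true, if_false, if_true]
  constructor <;> rintro ⟨h1, h2⟩ <;> constructor <;> linarith

lemma measurableSet_box (N : ℕ) : MeasurableSet (box d N) := by
  rw [box_eq, Set.ofPred_forall]
  exact MeasurableSet.iInter fun i => measurableSet_halfSpace _ _

lemma box_mono {M N : ℕ} (h : M ≤ N) : box d M ⊆ box d N := fun x hx i => by
  have h' : (M : ℝ) ≤ N := by exact_mod_cast h
  exact ⟨by linarith [(hx i).1], by linarith [(hx i).2]⟩

lemma volume_box (N : ℕ) : volume (box d N) = ENNReal.ofReal ((2 * N : ℝ) ^ d) := by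
  have h : box d N = (WithLp.ofLp : EuclideanSpace ℝ (Fin d) → Fin d → ℝ) ⁻¹'
      (Set.Icc (fun _ => -(N : ℝ)) (fun _ => (N : ℝ))) := by
    ext z
    simp [box, Pi.le_def, forall_and]
  rw [h, (PiLp.volume_preserving_ofLp (Fin d)).measure_preimage
    measurableSet_Icc.nullMeasurableSet, Real.volume_Icc_pi]
  simp only [Finset.prod_const, Finset.card_univ, Fintype.card_fin]
  rw [← ENNReal.ofReal_pow (by linarith [(Nat.cast_nonneg N : (0 : ℝ) ≤ N)])]
  congr 2
  ring

lemma boxVolume_eq (N : ℕ) : boxVolume d N = (2 * N : ℝ) ^ d := by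
  rw [boxVolume, volume_box, ENNReal.toReal_ofReal (by positivity)]

lemma boxVolume_pos {N : ℕ} (hN : 1 ≤ N) : 0 < boxVolume d N := by
  have : (0 : ℝ) < N := by exact_mod_cast hN
  rw [boxVolume_eq]
  positivity

lemma tendsto_boxVolume (hd : 1 ≤ d) : Tendsto (boxVolume d) atTop atTop := by
  have h : Tendsto (fun N : ℕ => (2 * N : ℝ)) atTop atTop :=
    tendsto_natCast_atTop_atTop.const_mul_atTop zero_lt_two
  exact ((tendsto_pow_atTop (by omega)).comp h).congr fun N => (boxVolume_eq N).symm

lemma heatKernel_self (t : ℝ) (x : EuclideanSpace ℝ (Fin d)) :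
    heatKernel d t x x = (4 * Real.pi * t) ^ (-(d : ℝ) / 2) := by
  simp [heatKernel]

/-- At a point whose distance to the boundary of the box is at least `M`, the Dirichlet heat kernel
is close to the free one. -/
lemma le_dirichletHeatKernel {t : ℝ} (ht : 0 < t) {M N : ℕ} (hMN : M ≤ N)
    {x : EuclideanSpace ℝ (Fin d)} (hx : x ∈ box d (N - M)) :
    ENNReal.ofReal ((4 * Real.pi * t) ^ (-(d : ℝ) / 2) *
      (1 - 2 * d * Real.exp (-(M : ℝ) ^ 2 / t))) ≤ dirichletHeatKernel d (box d N) t x x := by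
  refine le_iInf fun n => le_trans (ENNReal.ofReal_le_ofReal ?_)
    (le_dyadicKilledKernel norm_boxNormal (box_eq N) n ht (box_mono (Nat.sub_le N M) hx)
      (box_mono (Nat.sub_le N M) hx))
  rw [heatKernel_self]
  have hpi := Real.pi_pos
  have h : ∀ i, reflectedKernel (boxNormal i) N t x x ≤
      (4 * Real.pi * t) ^ (-(d : ℝ) / 2) * Real.exp (-(M : ℝ) ^ 2 / t) := fun i => by
    rw [reflectedKernel_eq (norm_boxNormal i) _ ht, heatKernel_self]
    have h1 : (M : ℝ) ≤ N - inner ℝ (boxNormal i) x := by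
      rw [box_eq] at hx
      have := hx i
      rw [Nat.cast_sub hMN] at this
      linarith
    have h2 : (0 : ℝ) ≤ M := Nat.cast_nonneg M
    gcongr
    nlinarith
  have h3 := Finset.sum_le_sum fun i (_ : i ∈ (Finset.univ : Finset (Fin d × Bool))) => h i
  rw [Finset.sum_const, Finset.card_univ, Fintype.card_prod, Fintype.card_fin, Fintype.card_bool,
    nsmul_eq_mul] at h3
  push_cast at h3
  linarith

end Killed

/-! ### Asymptotics of the cycle weights -/

section Weights

variable {d : ℕ} {β : ℝ}

lemma cycleWeight_eq_exp_mul (α : ℝ) (bc : BoundaryCondition) (N : ℕ) (k : ℕ+) :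
    cycleWeight d β α bc N k = cycleWeight d β 0 bc N k * Real.exp (β * α * k) := by
  cases bc
  · simp only [cycleWeight, freeWeight, mul_zero, zero_mul, Real.exp_zero]
    ring
  all_goals
    simp only [cycleWeight, mul_zero, zero_mul, Real.exp_zero]
    split_ifs
    · ring
    · simp

lemma freeWeight_eq (hβ : 0 < β) (k : ℕ+) :
    freeWeight d β 0 k = (4 * Real.pi * (k * β)) ^ (-(d : ℝ) / 2) / k := by
  have hk : (0 : ℝ) < k := by exact_mod_cast k.pos
  have hpi := Real.pi_pos
  rw [freeWeight_zero, show 4 * Real.pi * (k * β) = (4 * Real.pi * β) * k by ring, neg_div,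
    Real.rpow_neg (by positivity), Real.mul_rpow (by positivity) hk.le, Real.rpow_add hk,
    Real.rpow_one]
  field_simp

lemma cycleWeight_dirichlet_le (hβ : 0 < β) {N : ℕ} (hN : 1 ≤ N) (k : ℕ+) :
    cycleWeight d β 0 .dirichlet N k ≤ freeWeight d β 0 k := by
  have hk : (0 : ℝ) < k := by exact_mod_cast k.pos
  have hV := boxVolume_pos (d := d) hN
  have hpi := Real.pi_pos
  simp only [cycleWeight]
  split_ifs with h
  · have h1 : ∫⁻ x in box d N, dirichletHeatKernel d (box d N) (k * β) x x ≤
        ENNReal.ofReal ((4 * Real.pi * (k * β)) ^ (-(d : ℝ) / 2) * boxVolume d N) := by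
      calc ∫⁻ x in box d N, dirichletHeatKernel d (box d N) (k * β) x x
          ≤ ∫⁻ x in box d N, ENNReal.ofReal ((4 * Real.pi * (k * β)) ^ (-(d : ℝ) / 2)) :=
            lintegral_mono fun x => (iInf_le _ 0).trans (by
              rw [dyadicKilledKernel, heatKernel_self])
        _ = _ := by
            rw [setLIntegral_const, ENNReal.ofReal_mul (by positivity), boxVolume_eq, volume_box]
    have h2 := ENNReal.toReal_mono ENNReal.ofReal_ne_top h1
    rw [ENNReal.toReal_ofReal (by positivity)] at h2
    rw [freeWeight_eq hβ]
    simp only [mul_zero, zero_mul, Real.exp_zero]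
    calc 1 / (k * boxVolume d N) * _ ≤ 1 / (k * boxVolume d N) *
          ((4 * Real.pi * (k * β)) ^ (-(d : ℝ) / 2) * boxVolume d N) := by gcongr
      _ = _ := by field_simp
  · exact (freeWeight_pos hβ 0 k).le

lemma le_cycleWeight_dirichlet (hβ : 0 < β) {M N : ℕ} (hN : 1 ≤ N) (hMN : M ≤ N) {k : ℕ+}
    (hk : (k : ℕ) ≤ N) (hM : 0 ≤ 1 - 2 * d * Real.exp (-(M : ℝ) ^ 2 / (k * β))) :
    freeWeight d β 0 k * (1 - 2 * d * Real.exp (-(M : ℝ) ^ 2 / (k * β))) *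
      ((N - M : ℝ) / N) ^ d ≤ cycleWeight d β 0 .dirichlet N k := by
  have hk0 : (0 : ℝ) < k := by exact_mod_cast k.pos
  have hN0 : (0 : ℝ) < N := by exact_mod_cast hN
  have hMN' : (0 : ℝ) ≤ N - M := sub_nonneg.2 (by exact_mod_cast hMN)
  have hpi := Real.pi_pos
  set u := 1 - 2 * d * Real.exp (-(M : ℝ) ^ 2 / (k * β)) with hu
  set g := (4 * Real.pi * (k * β)) ^ (-(d : ℝ) / 2) with hg
  have hg0 : 0 < g := by positivity
  have h1 : ENNReal.ofReal (g * u * (2 * (N - M : ℝ)) ^ d) ≤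
      ∫⁻ x in box d N, dirichletHeatKernel d (box d N) (k * β) x x := by
    calc ENNReal.ofReal (g * u * (2 * (N - M : ℝ)) ^ d)
        = ∫⁻ x in box d (N - M), ENNReal.ofReal (g * u) := by
          rw [setLIntegral_const, volume_box, ← ENNReal.ofReal_mul (by positivity),
            Nat.cast_sub hMN]
      _ ≤ ∫⁻ x in box d (N - M), dirichletHeatKernel d (box d N) (k * β) x x :=
          setLIntegral_mono' (measurableSet_box _) fun x hx =>
            le_dirichletHeatKernel (by positivity) hMN hx
      _ ≤ _ := lintegral_mono_set (box_mono (Nat.sub_le N M))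
  have hfin : ∫⁻ x in box d N, dirichletHeatKernel d (box d N) (k * β) x x ≠ ⊤ := by
    refine ne_top_of_le_ne_top ?_ (lintegral_mono fun x => iInf_le _ 0)
    simp only [dyadicKilledKernel, heatKernel_self, setLIntegral_const, volume_box]
    exact ENNReal.mul_ne_top ENNReal.ofReal_ne_top ENNReal.ofReal_ne_top
  have h2 := ENNReal.toReal_mono hfin h1
  rw [ENNReal.toReal_ofReal (by positivity)] at h2
  simp only [cycleWeight, if_pos hk, mul_zero, zero_mul, Real.exp_zero]
  rw [freeWeight_eq hβ, ← hg, boxVolume_eq]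
  calc g / k * u * ((N - M : ℝ) / N) ^ d =
      1 / (k * (2 * N : ℝ) ^ d) * (g * u * (2 * (N - M : ℝ)) ^ d) := by
        rw [mul_pow, mul_pow, div_pow]
        field_simp
    _ ≤ _ := by gcongr

lemma tendsto_cycleWeight_dirichlet (hβ : 0 < β) (k : ℕ+) :
    Tendsto (fun N => cycleWeight d β 0 .dirichlet N k) atTop (𝓝 (freeWeight d β 0 k)) := by
  have hk0 : (0 : ℝ) < k := by exact_mod_cast k.pos
  refine tendsto_order.2 ⟨fun c hc => ?_, fun c hc => ?_⟩
  · have h1 : Tendsto (fun M : ℕ => 1 - 2 * d * Real.exp (-(M : ℝ) ^ 2 / (k * β))) atTop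
        (𝓝 (1 - 2 * d * 0)) := by
      refine ((Real.tendsto_exp_atBot.comp ?_).const_mul _).const_sub _
      refine Tendsto.atBot_div_const (by positivity) (tendsto_neg_atTop_atBot.comp ?_)
      exact (tendsto_pow_atTop two_ne_zero).comp tendsto_natCast_atTop_atTop
    have h2 : Tendsto (fun M : ℕ => freeWeight d β 0 k *
        (1 - 2 * d * Real.exp (-(M : ℝ) ^ 2 / (k * β)))) atTop (𝓝 (freeWeight d β 0 k)) := by
      simpa using h1.const_mul (freeWeight d β 0 k)
    obtain ⟨M, hM1, hM2⟩ := ((h2.eventually_const_lt hc).and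
      (h1.eventually_const_lt (u := 0) (by norm_num))).exists
    have h3 : Tendsto (fun N : ℕ => ((N - M : ℝ) / N) ^ d) atTop (𝓝 1) := by
      have h4 : Tendsto (fun N : ℕ => (1 - M / N : ℝ) ^ d) atTop (𝓝 ((1 - 0) ^ d)) :=
        ((tendsto_const_div_atTop_nhds_zero_nat (M : ℝ)).const_sub 1).pow d
      rw [sub_zero, one_pow] at h4
      refine h4.congr' ((eventually_ge_atTop 1).mono fun N hN => ?_)
      have : (N : ℝ) ≠ 0 := by exact_mod_cast (by omega : N ≠ 0)
      congr 1
      field_simp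
    have h5 := h3.const_mul (freeWeight d β 0 k *
        (1 - 2 * d * Real.exp (-(M : ℝ) ^ 2 / (k * β))))
    rw [mul_one] at h5
    filter_upwards [h5.eventually_const_lt hM1, eventually_ge_atTop 1, eventually_ge_atTop M,
      eventually_ge_atTop (k : ℕ)] with N h6 h7 h8 h9
    exact h6.trans_le (le_cycleWeight_dirichlet hβ h7 h8 h9 hM2.le)
  · filter_upwards [eventually_ge_atTop 1] with N hN
    exact (cycleWeight_dirichlet_le hβ hN k).trans_lt hc

/-- The theta series `∑_{j ∈ ℤ} exp(-s j²)`. -/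
noncomputable def thetaSum (s : ℝ) : ℝ := ∑' j : ℤ, Real.exp (-s * (j : ℝ) ^ 2)

lemma exp_neg_mul_sq_le {c s : ℝ} (hc : 0 ≤ c) (hs : c ≤ s) (j : ℤ) :
    Real.exp (-s * (j : ℝ) ^ 2) ≤ Real.exp (-c * |(j : ℝ)|) := by
  rw [Real.exp_le_exp]
  have h : |(j : ℝ)| ≤ (j : ℝ) ^ 2 := by
    rw [← sq_abs]
    rcases eq_or_ne j 0 with rfl | hj
    · simp
    · have : (1 : ℝ) ≤ |(j : ℝ)| := by exact_mod_cast Int.one_le_abs hj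
      nlinarith
  nlinarith [mul_le_mul hs h (abs_nonneg _) (hc.trans hs)]

lemma summable_exp_neg_mul_abs {c : ℝ} (hc : 0 < c) :
    Summable fun j : ℤ => Real.exp (-c * |(j : ℝ)|) := by
  have h : Summable fun n : ℕ => Real.exp (-c * n) := by
    have := Real.summable_exp_nat_mul_iff.2 (neg_lt_zero.2 hc)
    simpa only [mul_comm] using this
  refine Summable.of_nat_of_neg ?_ ?_ <;> simpa using h

lemma summable_thetaSum {s : ℝ} (hs : 0 < s) :
    Summable fun j : ℤ => Real.exp (-s * (j : ℝ) ^ 2) :=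
  (summable_exp_neg_mul_abs hs).of_nonneg_of_le (fun _ => (Real.exp_pos _).le)
    (exp_neg_mul_sq_le hs.le le_rfl)

lemma thetaSum_nonneg (s : ℝ) : 0 ≤ thetaSum s := tsum_nonneg fun _ => (Real.exp_pos _).le

lemma thetaSum_anti {c s : ℝ} (hc : 0 < c) (hs : c ≤ s) : thetaSum s ≤ thetaSum c :=
  (summable_thetaSum (hc.trans_le hs)).tsum_le_tsum (fun j => by gcongr) (summable_thetaSum hc)

lemma tendsto_thetaSum : Tendsto thetaSum atTop (𝓝 1) := by
  have h := tendsto_tsum_of_dominated_convergence (𝓕 := atTop)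
    (f := fun (s : ℝ) (j : ℤ) => Real.exp (-s * (j : ℝ) ^ 2))
    (g := fun j : ℤ => if j = 0 then (1 : ℝ) else 0)
    (summable_exp_neg_mul_abs one_pos) (fun j => ?_) ?_
  · rwa [tsum_ite_eq] at h
  · rcases eq_or_ne j 0 with rfl | hj
    · simp
    · rw [if_neg hj]
      refine Real.tendsto_exp_atBot.comp ?_
      have hj' : (0 : ℝ) < (j : ℝ) ^ 2 := by positivity
      exact tendsto_neg_atTop_atBot.atBot_mul_const hj'
  · filter_upwards [eventually_ge_atTop 1] with s hs j
    rw [Real.norm_of_nonneg (Real.exp_pos _).le]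
    exact exp_neg_mul_sq_le zero_le_one hs j

lemma ENNReal.tsum_pi_prod_eq_pow {ι : Type*} (f : ι → ℝ≥0∞) (n : ℕ) :
    ∑' z : Fin n → ι, ∏ i, f (z i) = (∑' j, f j) ^ n := by
  induction n with
  | zero => simp
  | succ n ih =>
    rw [← (Fin.consEquiv fun _ => ι).tsum_eq]
    simp only [Fin.consEquiv_apply, Fin.prod_univ_succ, Fin.cons_zero, Fin.cons_succ]
    rw [ENNReal.tsum_prod (f := fun a (z : Fin n → ι) => f a * ∏ i, f (z i))]
    simp only [ENNReal.tsum_mul_left, ih, ENNReal.tsum_mul_right]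
    rw [pow_succ, mul_comm]

/-- On the diagonal the heat kernel of the torus is the free heat kernel times a power of a theta
series. -/
lemma periodicHeatKernel_self {t : ℝ} (ht : 0 < t) {N : ℕ} (hN : 1 ≤ N)
    (x : EuclideanSpace ℝ (Fin d)) :
    periodicHeatKernel d (2 * N) t x x =
      ENNReal.ofReal ((4 * Real.pi * t) ^ (-(d : ℝ) / 2) * thetaSum ((N : ℝ) ^ 2 / t) ^ d) := by
  have hpi := Real.pi_pos
  have hN0 : (0 : ℝ) < N := by exact_mod_cast hN
  have hs : 0 < (N : ℝ) ^ 2 / t := by positivity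
  have h1 : ∀ z : Fin d → ℤ, ENNReal.ofReal (heatKernel d t x
      (x + WithLp.toLp 2 (fun i => 2 * (N : ℝ) * (z i : ℝ)))) =
      ENNReal.ofReal ((4 * Real.pi * t) ^ (-(d : ℝ) / 2)) *
        ∏ i, ENNReal.ofReal (Real.exp (-((N : ℝ) ^ 2 / t) * (z i : ℝ) ^ 2)) := by
    intro z
    rw [← ENNReal.ofReal_prod_of_nonneg fun i _ => (Real.exp_pos _).le,
      ← ENNReal.ofReal_mul (by positivity), heatKernel, ← Real.exp_sum, sub_add_cancel_left,
      norm_neg, EuclideanSpace.norm_sq_eq, ← Finset.mul_sum]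
    simp only [Real.norm_eq_abs, sq_abs, mul_pow, ← Finset.mul_sum]
    congr 3
    field_simp
    ring
  rw [periodicHeatKernel]
  simp only [h1]
  rw [ENNReal.tsum_mul_left,
    ENNReal.tsum_pi_prod_eq_pow
      (fun j : ℤ => ENNReal.ofReal (Real.exp (-((N : ℝ) ^ 2 / t) * (j : ℝ) ^ 2))),
    ← ENNReal.ofReal_tsum_of_nonneg (fun _ => (Real.exp_pos _).le) (summable_thetaSum hs),
    ← thetaSum, ← ENNReal.ofReal_pow (thetaSum_nonneg _), ← ENNReal.ofReal_mul (by positivity)]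

lemma cycleWeight_periodic (hβ : 0 < β) {N : ℕ} (hN : 1 ≤ N) {k : ℕ+} (hk : (k : ℕ) ≤ N) :
    cycleWeight d β 0 .periodic N k =
      freeWeight d β 0 k * thetaSum ((N : ℝ) ^ 2 / (k * β)) ^ d := by
  have hk0 : (0 : ℝ) < k := by exact_mod_cast k.pos
  have hpi := Real.pi_pos
  have hV := boxVolume_pos (d := d) hN
  have hθ := thetaSum_nonneg ((N : ℝ) ^ 2 / (k * β))
  simp only [cycleWeight, if_pos hk, mul_zero, zero_mul, Real.exp_zero,
    periodicHeatKernel_self (mul_pos hk0 hβ) hN]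
  rw [setLIntegral_const, volume_box, ← boxVolume_eq, ENNReal.toReal_mul,
    ENNReal.toReal_ofReal (by positivity), ENNReal.toReal_ofReal hV.le, freeWeight_eq hβ]
  field_simp

lemma cycleWeight_nonneg (hβ : 0 < β) (α : ℝ) (bc : BoundaryCondition) (N : ℕ) (k : ℕ+) :
    0 ≤ cycleWeight d β α bc N k := by
  have hk0 : (0 : ℝ) < k := by exact_mod_cast k.pos
  have hV : 0 ≤ boxVolume d N := ENNReal.toReal_nonneg
  cases bc
  · exact (freeWeight_pos hβ α k).le
  all_goals
    simp only [cycleWeight]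
    split_ifs <;> positivity

/-- For `k ≤ N` the torus is large compared with the typical distance covered by a cycle of length
`k`, so the cycle weights are uniformly comparable to the free ones. -/
lemma exists_cycleWeight_le (hβ : 0 < β) (bc : BoundaryCondition) :
    ∃ C : ℝ, ∀ N : ℕ, 1 ≤ N → ∀ k, cycleWeight d β 0 bc N k ≤ C * freeWeight d β 0 k := by
  cases bc
  · exact ⟨1, fun N _ k => by rw [one_mul]; rfl⟩
  · refine ⟨thetaSum (1 / β) ^ d, fun N hN k => ?_⟩
    have hq := freeWeight_pos (d := d) hβ 0 k
    by_cases hk : (k : ℕ) ≤ N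
    · have hk0 : (0 : ℝ) < k := by exact_mod_cast k.pos
      have hN1 : (1 : ℝ) ≤ N := by exact_mod_cast hN
      have hk' : (k : ℝ) ≤ N := by exact_mod_cast hk
      rw [cycleWeight_periodic hβ hN hk, mul_comm]
      refine mul_le_mul_of_nonneg_right ?_ hq.le
      refine pow_le_pow_left₀ (thetaSum_nonneg _) (thetaSum_anti (by positivity) ?_) d
      rw [div_le_div_iff₀ hβ (by positivity)]
      nlinarith [mul_le_mul_of_nonneg_right (show (k : ℝ) ≤ (N : ℝ) ^ 2 by nlinarith) hβ.le]
    · simp only [cycleWeight, if_neg hk]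
      exact mul_nonneg (pow_nonneg (thetaSum_nonneg _) d) hq.le
  · exact ⟨1, fun N hN k => by rw [one_mul]; exact cycleWeight_dirichlet_le hβ hN k⟩

lemma tendsto_cycleWeight (hβ : 0 < β) (bc : BoundaryCondition) (k : ℕ+) :
    Tendsto (fun N => cycleWeight d β 0 bc N k) atTop (𝓝 (freeWeight d β 0 k)) := by
  cases bc
  · exact tendsto_const_nhds
  · have hk0 : (0 : ℝ) < k := by exact_mod_cast k.pos
    have h1 : Tendsto (fun N : ℕ => (N : ℝ) ^ 2 / (k * β)) atTop atTop :=
      ((tendsto_pow_atTop two_ne_zero).comp tendsto_natCast_atTop_atTop).atTop_div_const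
        (by positivity)
    have h2 := ((tendsto_thetaSum.comp h1).pow d).const_mul (freeWeight d β 0 k)
    rw [one_pow, mul_one] at h2
    refine h2.congr' ?_
    filter_upwards [eventually_ge_atTop 1, eventually_ge_atTop (k : ℕ)] with N hN hk
    exact (cycleWeight_periodic hβ hN hk).symm
  · exact tendsto_cycleWeight_dirichlet hβ k

lemma summable_cycleWeight (hd : 1 ≤ d) (hβ : 0 < β) (bc : BoundaryCondition) {N : ℕ}
    (hN : 1 ≤ N) : Summable fun k => cycleWeight d β 0 bc N k := by
  obtain ⟨C, hC⟩ := exists_cycleWeight_le (d := d) hβ bc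
  exact ((summable_freeWeight hd).mul_left C).of_nonneg_of_le
    (fun k => cycleWeight_nonneg hβ 0 bc N k) (hC N hN)

end Weights

/-! ### The reference measure and the HYL measure as sums of point masses -/

section PointMasses

variable {d : ℕ} {β a b : ℝ} {bc : BoundaryCondition} {N : ℕ}

/-- The empirical cycle count `(nₖ / V)ₖ` for cycle counts `n`. -/
noncomputable def empiricalPoint (V : ℝ) (n : ℕ+ →₀ ℕ) : EllOne :=
  finPoint n.support fun k => (n k : ℝ) / V

lemma empiricalPoint_apply (V : ℝ) (n : ℕ+ →₀ ℕ) (k : ℕ+) :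
    empiricalPoint V n k = (n k : ℝ) / V := by
  rw [empiricalPoint, finPoint_apply]
  split_ifs with h
  · rfl
  · simp [Finsupp.notMem_support_iff.1 h]

lemma ofFun_eq_empiricalPoint (V : ℝ) (n : ℕ+ →₀ ℕ) :
    EllOne.ofFun (fun k => (n k : ℝ) / V) = empiricalPoint V n := by
  have h : (fun k => (n k : ℝ) / V) = ⇑(empiricalPoint V n) :=
    funext fun k => (empiricalPoint_apply V n k).symm
  have hm : Memℓp (fun k => (n k : ℝ) / V) 1 := by
    rw [h]
    exact lp.memℓp _
  rw [EllOne.ofFun, dif_pos hm]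
  exact lp.ext h

lemma isNonneg_empiricalPoint {V : ℝ} (hV : 0 ≤ V) (n : ℕ+ →₀ ℕ) :
    IsNonneg (empiricalPoint V n) := fun k => by
  rw [empiricalPoint_apply]
  positivity

/-- The probability that the cycle counts in `Λ_N` are `n`. -/
noncomputable def cycleCountWeight (d : ℕ) (β α : ℝ) (bc : BoundaryCondition) (N : ℕ)
    (n : ℕ+ →₀ ℕ) : ℝ :=
  poissonWeight (fun k => boxVolume d N * cycleWeight d β α bc N k) n

lemma boxMean_nonneg (hβ : 0 < β) (α : ℝ) (k : ℕ+) :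
    0 ≤ boxVolume d N * cycleWeight d β α bc N k :=
  mul_nonneg ENNReal.toReal_nonneg (cycleWeight_nonneg hβ α bc N k)

lemma cycleCountWeight_nonneg (hβ : 0 < β) (α : ℝ) (n : ℕ+ →₀ ℕ) :
    0 ≤ cycleCountWeight d β α bc N n :=
  poissonWeight_nonneg (boxMean_nonneg hβ α) n

lemma summable_boxMean (hd : 1 ≤ d) (hβ : 0 < β) {α : ℝ} (hα : α ≤ 0) (hN : 1 ≤ N) :
    Summable fun k => boxVolume d N * cycleWeight d β α bc N k := by
  refine Summable.mul_left _ ((summable_cycleWeight hd hβ bc hN).of_nonneg_of_le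
    (fun k => cycleWeight_nonneg hβ α bc N k) fun k => ?_)
  rw [cycleWeight_eq_exp_mul]
  refine mul_le_of_le_one_right (cycleWeight_nonneg hβ 0 bc N k) (Real.exp_le_one_iff.2 ?_)
  have : β * α ≤ 0 := mul_nonpos_of_nonneg_of_nonpos hβ.le hα
  exact mul_nonpos_of_nonpos_of_nonneg this (Nat.cast_nonneg _)

lemma referenceMeasure_eq_sum (hd : 1 ≤ d) (hβ : 0 < β) {α : ℝ} (hα : α ≤ 0) (hN : 1 ≤ N) :
    referenceMeasure d β α bc N = Measure.sum fun n : ℕ+ →₀ ℕ =>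
      ENNReal.ofReal (cycleCountWeight d β α bc N n) •
        Measure.dirac (empiricalPoint (boxVolume d N) n) := by
  rw [referenceMeasure, cycleCountLaw,
    infinitePi_poissonMeasure_eq_sum (boxMean_nonneg hβ α) (summable_boxMean hd hβ hα hN),
    Measure.map_sum]
  · congr 1
    funext n
    rw [Measure.map_smul, Measure.map_dirac, ofFun_eq_empiricalPoint]
    rfl
  · exact aemeasurable_sum_measure_iff.2 fun n => aemeasurable_dirac.smul_measure _

lemma lintegral_referenceMeasure (hd : 1 ≤ d) (hβ : 0 < β) {α : ℝ} (hα : α ≤ 0) (hN : 1 ≤ N)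
    (f : EllOne → ℝ≥0∞) :
    ∫⁻ x, f x ∂(referenceMeasure d β α bc N) =
      ∑' n, ENNReal.ofReal (cycleCountWeight d β α bc N n) *
        f (empiricalPoint (boxVolume d N) n) := by
  rw [referenceMeasure_eq_sum hd hβ hα hN, lintegral_sum_measure]
  simp only [lintegral_smul_measure, lintegral_dirac, smul_eq_mul]

lemma tsum_cycleCountWeight (hd : 1 ≤ d) (hβ : 0 < β) {α : ℝ} (hα : α ≤ 0) (hN : 1 ≤ N) :
    ∑' n, ENNReal.ofReal (cycleCountWeight d β α bc N n) = 1 :=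
  tsum_poissonWeight (boxMean_nonneg hβ α) (summable_boxMean hd hβ hα hN)

theorem isProbabilityMeasure_referenceMeasure (hd : 1 ≤ d) (hβ : 0 < β) {α : ℝ} (hα : α ≤ 0)
    (hN : 1 ≤ N) : IsProbabilityMeasure (referenceMeasure d β α bc N) := by
  constructor
  have h := lintegral_referenceMeasure (bc := bc) hd hβ hα hN fun _ => 1
  simpa [tsum_cycleCountWeight hd hβ hα hN] using h

/-- The weight of the cycle counts `n` in the partition function. -/
noncomputable def gibbsWeight (d : ℕ) (β a b m α : ℝ) (bc : BoundaryCondition) (N : ℕ)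
    (n : ℕ+ →₀ ℕ) : ℝ :=
  cycleCountWeight d β α bc N n *
    Real.exp (-(β * boxVolume d N * hylEnergy a b m (empiricalPoint (boxVolume d N) n)))

/-- The unnormalised HYL measure for `α = 0` and chemical potential `m`. -/
noncomputable def gibbsMeasure (d : ℕ) (β a b m : ℝ) (bc : BoundaryCondition) (N : ℕ) :
    Measure EllOne :=
  Measure.sum fun n : ℕ+ →₀ ℕ => ENNReal.ofReal (gibbsWeight d β a b m 0 bc N n) •
    Measure.dirac (empiricalPoint (boxVolume d N) n)

lemma gibbsMeasure_apply (m : ℝ) (A : Set EllOne) :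
    gibbsMeasure d β a b m bc N A = ∑' n, ENNReal.ofReal (gibbsWeight d β a b m 0 bc N n) *
      A.indicator 1 (empiricalPoint (boxVolume d N) n) := by
  rw [gibbsMeasure, Measure.sum_apply_of_countable]
  simp only [Measure.smul_apply, Measure.dirac_apply, smul_eq_mul]

lemma hylBoltzmann_empiricalPoint (m : ℝ) (n : ℕ+ →₀ ℕ) :
    hylBoltzmann d β a b m N (empiricalPoint (boxVolume d N) n) =
      ENNReal.ofReal (Real.exp
        (-(β * boxVolume d N * hylEnergy a b m (empiricalPoint (boxVolume d N) n)))) := by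
  rw [hylBoltzmann, hylHamiltonian, if_pos ⟨isNonneg_empiricalPoint ENNReal.toReal_nonneg n,
    finiteDensity_finPoint _ _⟩, ← EReal.coe_mul, ← EReal.coe_neg, EReal.exp_coe]

lemma density_empiricalPoint {V : ℝ} (n : ℕ+ →₀ ℕ) :
    density (empiricalPoint V n) = (n.sum fun k j => (k : ℝ) * j) / V := by
  rw [empiricalPoint, density_finPoint, Finsupp.sum, Finset.sum_div]
  exact Finset.sum_congr rfl fun k _ => by ring

/-- The chemical potential `α` of the reference process and the chemical potential `μ` of the
Hamiltonian enter only through `μ + α`, up to a factor which does not depend on the cycle counts. -/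
lemma exists_gibbsWeight_eq (hd : 1 ≤ d) (hβ : 0 < β) {α : ℝ} (hα : α ≤ 0) (hN : 1 ≤ N)
    (a b μ : ℝ) :
    ∃ c : ℝ, 0 < c ∧ ∀ n, gibbsWeight d β a b μ α bc N n =
      c * gibbsWeight d β a b (μ + α) 0 bc N n := by
  have hV := boxVolume_pos (d := d) hN
  have hmean : (fun k : ℕ+ => boxVolume d N * cycleWeight d β α bc N k) =
      fun k : ℕ+ => boxVolume d N * cycleWeight d β 0 bc N k * Real.exp (β * α * k) := by
    funext k
    rw [cycleWeight_eq_exp_mul, ← mul_assoc]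
  have hs := summable_boxMean (bc := bc) hd hβ hα hN
  rw [hmean] at hs
  refine ⟨Real.exp (-∑' k : ℕ+, boxVolume d N * cycleWeight d β 0 bc N k *
    (Real.exp (β * α * k) - 1)), Real.exp_pos _, fun n => ?_⟩
  have h := poissonWeight_tilt (summable_boxMean (bc := bc) hd hβ le_rfl hN) hs n
  have e1 : (n.sum fun k j => β * α * (k : ℝ) * j) =
      β * boxVolume d N * (α * density (empiricalPoint (boxVolume d N) n)) := by
    rw [density_empiricalPoint, Finsupp.sum, Finsupp.sum]
    field_simp
    rw [Finset.mul_sum]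
    exact Finset.sum_congr rfl fun k _ => by ring
  have e2 : hylEnergy a b (μ + α) (empiricalPoint (boxVolume d N) n) =
      hylEnergy a b μ (empiricalPoint (boxVolume d N) n) -
        α * density (empiricalPoint (boxVolume d N) n) := by
    rw [hylEnergy, hylEnergy]
    ring
  rw [gibbsWeight, gibbsWeight, cycleCountWeight, cycleCountWeight, hmean, e2, mul_sub, neg_sub,
    sub_eq_add_neg, Real.exp_add, ← e1, ← mul_assoc, ← mul_assoc, mul_assoc _ (poissonWeight _ n),
    h, Real.exp_neg (tsum _)]
  field_simp

lemma hylPartition_eq_tsum (hd : 1 ≤ d) (hβ : 0 < β) {α : ℝ} (hα : α ≤ 0) (hN : 1 ≤ N) (μ : ℝ) :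
    hylPartition d β a b μ α bc N = ∑' n, ENNReal.ofReal (gibbsWeight d β a b μ α bc N n) := by
  rw [hylPartition, lintegral_referenceMeasure hd hβ hα hN]
  refine tsum_congr fun n => ?_
  rw [hylBoltzmann_empiricalPoint, gibbsWeight, ENNReal.ofReal_mul (cycleCountWeight_nonneg hβ α n)]

theorem hylMeasure_apply (hd : 1 ≤ d) (hβ : 0 < β) {α : ℝ} (hα : α ≤ 0) (hN : 1 ≤ N) (μ : ℝ)
    {A : Set EllOne} (hA : MeasurableSet A) :
    hylMeasure d β a b μ α bc N A =
      gibbsMeasure d β a b (μ + α) bc N A / gibbsMeasure d β a b (μ + α) bc N Set.univ := by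
  obtain ⟨c, hc, hcn⟩ := exists_gibbsWeight_eq (bc := bc) hd hβ hα hN a b μ
  have hc0 : ENNReal.ofReal c ≠ 0 := (ENNReal.ofReal_pos.2 hc).ne'
  have hZ : hylPartition d β a b μ α bc N =
      ENNReal.ofReal c * gibbsMeasure d β a b (μ + α) bc N Set.univ := by
    rw [hylPartition_eq_tsum hd hβ hα hN, gibbsMeasure_apply, ← ENNReal.tsum_mul_left]
    refine tsum_congr fun n => ?_
    rw [hcn, ENNReal.ofReal_mul hc.le]
    simp
  rw [hylMeasure, withDensity_apply _ hA, ← lintegral_indicator hA,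
    lintegral_referenceMeasure hd hβ hα hN, hZ,
    ← ENNReal.mul_div_mul_left (gibbsMeasure d β a b (μ + α) bc N A) _ hc0 ENNReal.ofReal_ne_top,
    gibbsMeasure_apply _ A, ← ENNReal.tsum_mul_left, div_eq_mul_inv, ← ENNReal.tsum_mul_right]
  refine tsum_congr fun n => ?_
  by_cases hn : empiricalPoint (boxVolume d N) n ∈ A
  · rw [Set.indicator_of_mem hn, Set.indicator_of_mem hn, hylBoltzmann_empiricalPoint,
      ← mul_assoc (ENNReal.ofReal c), ← ENNReal.ofReal_mul hc.le, ← hcn, gibbsWeight,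
      ENNReal.ofReal_mul (cycleCountWeight_nonneg hβ α n), div_eq_mul_inv, Pi.one_apply, mul_one,
      ← mul_assoc (ENNReal.ofReal _)]
  · simp [Set.indicator_of_notMem hn]

/-- Chebyshev's inequality with the exponential moments of the Poisson point process. -/
theorem gibbsMeasure_le (hd : 1 ≤ d) (hβ : 0 < β) (hN : 1 ≤ N) {m c : ℝ} {θ : ℕ+ → ℝ}
    (hθ : Summable fun k => cycleWeight d β 0 bc N k * Real.exp (θ k)) {A : Set EllOne}
    (hA : ∀ x ∈ A, IsNonneg x → ∀ s f, x = finPoint s f →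
      c ≤ β * hylEnergy a b m x + ∑ k ∈ s, θ k * f k) :
    gibbsMeasure d β a b m bc N A ≤ ENNReal.ofReal (Real.exp (-(boxVolume d N *
      (c - ∑' k, cycleWeight d β 0 bc N k * (Real.exp (θ k) - 1))))) := by
  have hV := boxVolume_pos (d := d) hN
  set V := boxVolume d N with hVdef
  have hθ' : Summable fun k => V * cycleWeight d β 0 bc N k * Real.exp (θ k) := by
    simpa only [mul_assoc] using hθ.mul_left V
  have h1 := tsum_poissonWeight_mul_exp (boxMean_nonneg (d := d) (N := N) (bc := bc) hβ 0)
    (summable_boxMean hd hβ le_rfl hN) hθ'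
  calc gibbsMeasure d β a b m bc N A
      ≤ ∑' n : ℕ+ →₀ ℕ, ENNReal.ofReal (Real.exp (-(V * c))) *
          ENNReal.ofReal (cycleCountWeight d β 0 bc N n *
            Real.exp (n.sum fun k j => θ k * j)) := by
        rw [gibbsMeasure_apply]
        refine ENNReal.tsum_le_tsum fun n => ?_
        by_cases hn : empiricalPoint V n ∈ A
        · rw [Set.indicator_of_mem hn, Pi.one_apply, mul_one,
            ← ENNReal.ofReal_mul (Real.exp_pos _).le, gibbsWeight, mul_left_comm, ← Real.exp_add]
          refine ENNReal.ofReal_le_ofReal (mul_le_mul_of_nonneg_left (Real.exp_le_exp.2 ?_)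
            (cycleCountWeight_nonneg hβ 0 n))
          have h2 := hA _ hn (isNonneg_empiricalPoint hV.le n) _ _ rfl
          have h3 : V * ∑ k ∈ n.support, θ k * ((n k : ℝ) / V) = n.sum fun k j => θ k * j := by
            rw [Finsupp.sum, Finset.mul_sum]
            refine Finset.sum_congr rfl fun k _ => ?_
            field_simp
          have h4 := mul_le_mul_of_nonneg_left h2 hV.le
          rw [mul_add, h3] at h4
          rw [← hVdef]
          linarith
        · rw [Set.indicator_of_notMem hn, mul_zero]
          exact zero_le
    _ = ENNReal.ofReal (Real.exp (-(V * c))) * ENNReal.ofReal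
          (Real.exp (∑' k, V * cycleWeight d β 0 bc N k * (Real.exp (θ k) - 1))) := by
        rw [ENNReal.tsum_mul_left, ← h1]
        rfl
    _ = _ := by
        rw [← ENNReal.ofReal_mul (Real.exp_pos _).le, ← Real.exp_add]
        simp only [mul_assoc, tsum_mul_left]
        congr 2
        ring

lemma le_gibbsMeasure (m : ℝ) {A : Set EllOne} {n : ℕ+ →₀ ℕ}
    (hn : empiricalPoint (boxVolume d N) n ∈ A) :
    ENNReal.ofReal (gibbsWeight d β a b m 0 bc N n) ≤ gibbsMeasure d β a b m bc N A := by
  rw [gibbsMeasure_apply]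
  refine le_trans (le_of_eq ?_) (ENNReal.le_tsum n)
  rw [Set.indicator_of_mem hn, Pi.one_apply, mul_one]

lemma regEnergy_le_hylEnergy (hb : 0 ≤ b) (hab : b < a) (m : ℝ) {x : EllOne} (hx : IsNonneg x)
    (hD : FiniteDensity x) : regEnergy a b m 0 0 ≤ hylEnergy a b m x := by
  have h := (regHamiltonian_ge a b m x).trans (regHamiltonian_le hb hab m x)
  rw [hylHamiltonian, if_pos ⟨hx, hD⟩] at h
  exact_mod_cast h

lemma gibbsMeasure_univ_ne_top (hd : 1 ≤ d) (hβ : 0 < β) (hb : 0 ≤ b) (hab : b < a) (hN : 1 ≤ N)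
    (m : ℝ) : gibbsMeasure d β a b m bc N Set.univ ≠ ⊤ := by
  refine ne_top_of_le_ne_top ENNReal.ofReal_ne_top (gibbsMeasure_le hd hβ hN (θ := 0)
    (c := β * regEnergy a b m 0 0) ?_ ?_)
  · simpa using summable_cycleWeight hd hβ bc hN
  · rintro x - hx s f rfl
    have := regEnergy_le_hylEnergy hb hab m hx (finiteDensity_finPoint s f)
    simpa using mul_le_mul_of_nonneg_left this hβ.le

lemma gibbsMeasure_univ_ne_zero (m : ℝ) : gibbsMeasure d β a b m bc N Set.univ ≠ 0 := by
  refine (lt_of_lt_of_le (ENNReal.ofReal_pos.2 ?_) (le_gibbsMeasure m (n := 0)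
    (Set.mem_univ _))).ne'
  simp only [gibbsWeight, cycleCountWeight, poissonWeight, Finsupp.prod_zero_index]
  positivity

theorem isProbabilityMeasure_hylMeasure (hd : 1 ≤ d) (hβ : 0 < β) (hb : 0 ≤ b) (hab : b < a)
    {α : ℝ} (hα : α ≤ 0) (hN : 1 ≤ N) (μ : ℝ) :
    IsProbabilityMeasure (hylMeasure d β a b μ α bc N) := by
  constructor
  rw [hylMeasure_apply hd hβ hα hN μ MeasurableSet.univ]
  exact ENNReal.div_self (gibbsMeasure_univ_ne_zero _)
    (gibbsMeasure_univ_ne_top hd hβ hb hab hN _)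

end PointMasses

/-! ### Upper bounds: local estimates and exponential tightness -/

section Upper

variable {d : ℕ} {β a b : ℝ} {bc : BoundaryCondition}

/-- The functional `β H_{m,l.s.c.} + I`, written with the explicit regularised Hamiltonian. -/
noncomputable def regFunctional (d : ℕ) (β a b m : ℝ) (x : EllOne) : EReal :=
  (β : EReal) * regHamiltonian a b m x + (idealRate d β 0 x : EReal)

lemma exists_split_of_lt_regFunctional (hβ : 0 < β) {m c : ℝ} {x : EllOne}
    (hc : (c : EReal) < regFunctional d β a b m x) :
    ∃ c₁ c₂ : ℝ, (c₁ : EReal) < regHamiltonian a b m x ∧ (c₂ : EReal) < idealRate d β 0 x ∧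
      c < β * c₁ + c₂ := by
  have hlow := regHamiltonian_ge a b m x
  have hI : ((-1 : ℝ) : EReal) < idealRate d β 0 x :=
    lt_of_lt_of_le (by exact_mod_cast neg_one_lt_zero) (EReal.coe_ennreal_nonneg _)
  rw [regFunctional] at hc
  induction h : regHamiltonian a b m x with
  | bot =>
    rw [h] at hlow
    exact absurd hlow (not_le.2 (EReal.bot_lt_coe _))
  | top =>
    refine ⟨(c + 2) / β, -1, EReal.coe_lt_top _, hI, ?_⟩
    rw [mul_div_cancel₀ _ hβ.ne']
    linarith
  | coe r =>
    rw [h, ← EReal.coe_mul, add_comm] at hc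
    have hc' : ((c - β * r : ℝ) : EReal) < idealRate d β 0 x := by
      rw [EReal.coe_sub, EReal.sub_lt_iff (Or.inl (EReal.coe_ne_bot _))
        (Or.inl (EReal.coe_ne_top _))]
      exact hc
    obtain ⟨c₂, h1, h2⟩ := EReal.lt_iff_exists_real_btwn.1 hc'
    have h1 : c - β * r < c₂ := by exact_mod_cast h1
    refine ⟨r - (c₂ - (c - β * r)) / (2 * β), c₂, ?_, h2, ?_⟩
    · have : 0 < (c₂ - (c - β * r)) / (2 * β) := div_pos (by linarith) (by linarith)
      exact_mod_cast sub_lt_self r this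
    · have : β * (r - (c₂ - (c - β * r)) / (2 * β)) = β * r - (c₂ - (c - β * r)) / 2 := by
        field_simp
      linarith

lemma exists_sum_of_lt_idealRate (hβ : 0 < β) {x : EllOne} (hx : IsNonneg x) {c : ℝ}
    (hc : (c : EReal) < idealRate d β 0 x) :
    ∃ s : Finset ℕ+, c < ∑ k ∈ s, rateTerm (freeWeight d β 0 k) (x k) := by
  have h0 : ∀ k, 0 ≤ rateTerm (freeWeight d β 0 k) (x k) := fun k =>
    rateTerm_nonneg (freeWeight_pos hβ 0 k) (hx k)
  rcases lt_or_ge c 0 with hc0 | hc0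
  · exact ⟨∅, by simpa using hc0⟩
  · have h1 : ENNReal.ofReal c < idealRate d β 0 x := by
      rw [← EReal.coe_ennreal_lt_coe_ennreal_iff, EReal.coe_ennreal_ofReal, max_eq_left hc0]
      exact hc
    rw [idealRate_of_isNonneg hx, ENNReal.tsum_eq_iSup_sum, lt_iSup_iff] at h1
    obtain ⟨s, hs⟩ := h1
    rw [← ENNReal.ofReal_sum_of_nonneg fun k _ => h0 k] at hs
    exact ⟨s, (ENNReal.ofReal_lt_ofReal_iff_of_nonneg hc0).1 hs⟩

lemma exists_tilt_of_lt_sum_rateTerm (hβ : 0 < β) {x : EllOne} (hx : IsNonneg x)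
    {s : Finset ℕ+} {c : ℝ} (hc : c < ∑ k ∈ s, rateTerm (freeWeight d β 0 k) (x k)) :
    ∃ θ : ℕ+ → ℝ, c < ∑ k ∈ s, (θ k * x k - freeWeight d β 0 k * (Real.exp (θ k) - 1)) := by
  set r := fun k => rateTerm (freeWeight d β 0 k) (x k) with hr
  set η := (∑ k ∈ s, r k - c) / (s.card + 1) with hη
  have hη0 : 0 < η := div_pos (by linarith) (by positivity)
  have hηs : η * (s.card + 1) = ∑ k ∈ s, r k - c := by
    rw [hη]
    field_simp
  choose θ hθ using fun k => exists_lt_of_lt_rateTerm (freeWeight_pos (d := d) hβ 0 k) (hx k)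
    (sub_lt_self (r k) hη0)
  refine ⟨θ, ?_⟩
  calc c < ∑ k ∈ s, (r k - η) := by
        rw [Finset.sum_sub_distrib, Finset.sum_const, nsmul_eq_mul]
        linarith
    _ ≤ _ := Finset.sum_le_sum fun k _ => (hθ k).le

lemma hasSum_mul_finPoint (θ : ℕ+ → ℝ) (s : Finset ℕ+) (f : ℕ+ → ℝ) :
    HasSum (fun k => θ k * finPoint s f k) (∑ k ∈ s, θ k * f k) :=
  hasSum_comp_finPoint s f (φ := fun k t => θ k * t) (by simp)

theorem exists_nhds_gibbsMeasure_le (hd : 1 ≤ d) (hβ : 0 < β) (hb : 0 ≤ b) (hab : b < a) (m : ℝ)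
    (x : EllOne) (c : ℝ) (hc : (c : EReal) < regFunctional d β a b m x) :
    ∃ U ∈ 𝓝 x, ∀ᶠ N in atTop, gibbsMeasure d β a b m bc N U ≤
      ENNReal.ofReal (Real.exp (-(boxVolume d N * c))) := by
  classical
  by_cases hx : IsNonneg x
  · obtain ⟨c₁, c₂, hc₁, hc₂, hcc⟩ := exists_split_of_lt_regFunctional hβ hc
    obtain ⟨s, hs⟩ := exists_sum_of_lt_idealRate hβ hx hc₂
    obtain ⟨θ, hθ⟩ := exists_tilt_of_lt_sum_rateTerm hβ hx hs
    rw [Finset.sum_sub_distrib] at hθ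
    set T := ∑ k ∈ s, θ k * x k with hT
    set Q := ∑ k ∈ s, freeWeight d β 0 k * (Real.exp (θ k) - 1) with hQ
    obtain ⟨ε, hε, hεc⟩ : ∃ ε, 0 < ε ∧ c + 2 * ε ≤ β * c₁ + (T - Q) :=
      ⟨(β * c₁ + (T - Q) - c) / 2, by linarith, by linarith⟩
    have hcont : Continuous fun y : EllOne => ∑ k ∈ s, θ k * y k :=
      continuous_finsetSum _ fun k _ => continuous_const.mul (continuous_coord k)
    refine ⟨{y | (c₁ : EReal) < regHamiltonian a b m y ∧ T - ε < ∑ k ∈ s, θ k * y k},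
      (lowerSemicontinuous_regHamiltonian a b m x _ hc₁).and
        (hcont.tendsto x |>.eventually_const_lt (sub_lt_self T hε)), ?_⟩
    -- the exponential tilt only acts on the finitely many cycle lengths in `s`
    set θ' : ℕ+ → ℝ := fun k => if k ∈ s then θ k else 0 with hθ'
    have hQN : ∀ N, ∑' k, cycleWeight d β 0 bc N k * (Real.exp (θ' k) - 1) =
        ∑ k ∈ s, cycleWeight d β 0 bc N k * (Real.exp (θ k) - 1) := fun N => by
      rw [tsum_eq_sum (s := s) fun k hk => by simp [hθ', hk]]
      exact Finset.sum_congr rfl fun k hk => by simp [hθ', hk]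
    have hQlim : Tendsto (fun N => ∑ k ∈ s, cycleWeight d β 0 bc N k * (Real.exp (θ k) - 1)) atTop
        (𝓝 Q) := tendsto_finsetSum _ fun k _ => (tendsto_cycleWeight hβ bc k).mul_const _
    filter_upwards [eventually_ge_atTop 1,
      hQlim.eventually_lt_const (lt_add_of_pos_right Q hε)] with N hN hQε
    have hV := boxVolume_pos (d := d) hN
    refine (gibbsMeasure_le hd hβ hN (θ := θ') (c := β * c₁ + (T - ε)) ?_ ?_).trans ?_
    · have h1 : Summable fun k => cycleWeight d β 0 bc N k * (Real.exp (θ' k) - 1) :=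
        summable_of_ne_finset_zero (s := s) fun k hk => by simp [hθ', hk]
      refine (h1.add (summable_cycleWeight hd hβ bc hN)).congr fun k => by ring
    · rintro _ ⟨hy1, hy2⟩ hy t f rfl
      have h1 : c₁ ≤ hylEnergy a b m (finPoint t f) := by
        have := hy1.trans_le (regHamiltonian_le hb hab m _)
        rw [hylHamiltonian, if_pos ⟨hy, finiteDensity_finPoint t f⟩] at this
        exact_mod_cast this.le
      have h2 : ∑ k ∈ t, θ' k * f k = ∑ k ∈ s, θ k * finPoint t f k := by
        rw [← (hasSum_mul_finPoint θ' t f).tsum_eq,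
          tsum_eq_sum (s := s) fun k hk => by simp [hθ', hk]]
        exact Finset.sum_congr rfl fun k hk => by simp [hθ', hk]
      rw [h2]
      exact add_le_add (mul_le_mul_of_nonneg_left h1 hβ.le) hy2.le
    · rw [hQN]
      refine ENNReal.ofReal_le_ofReal (Real.exp_le_exp.2 (neg_le_neg ?_))
      exact mul_le_mul_of_nonneg_left (by linarith) hV.le
  · refine ⟨{y | IsNonneg y}ᶜ, isClosed_isNonneg.isOpen_compl.mem_nhds hx, ?_⟩
    filter_upwards [eventually_ge_atTop 1] with N hN
    refine (gibbsMeasure_le hd hβ hN (θ := 0) (c := c) ?_ ?_).trans ?_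
    · simpa using summable_cycleWeight hd hβ bc hN
    · intro y hy hy'
      exact absurd hy' hy
    · simp

/-- A set of nonnegative sequences whose weighted sums are bounded, for weights tending to infinity,
is compact in `ℓ₁(ℝ)`. -/
lemma isCompact_weighted {θ : ℕ+ → ℝ} (hθ1 : ∀ k, 1 ≤ θ k) (hθ : Tendsto θ cofinite atTop)
    (L : ℝ) : IsCompact {x : EllOne | IsNonneg x ∧ ∀ s : Finset ℕ+, ∑ k ∈ s, θ k * x k ≤ L} := by
  classical
  have hclosed : IsClosed {x : EllOne | IsNonneg x ∧ ∀ s : Finset ℕ+, ∑ k ∈ s, θ k * x k ≤ L} := by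
    have heq : {x : EllOne | IsNonneg x ∧ ∀ s : Finset ℕ+, ∑ k ∈ s, θ k * x k ≤ L} =
        {x : EllOne | IsNonneg x} ∩ ⋂ s : Finset ℕ+, {x : EllOne | ∑ k ∈ s, θ k * x k ≤ L} := by
      ext x
      simp
    rw [heq]
    exact isClosed_isNonneg.inter <| isClosed_iInter fun s => isClosed_le
      (continuous_finsetSum _ fun k _ => continuous_const.mul (continuous_coord k))
      continuous_const
  refine TotallyBounded.isCompact_of_isClosed ?_ hclosed
  rw [Metric.totallyBounded_iff]
  intro ε hε
  obtain ⟨M, hM0, hM⟩ : ∃ M : ℝ, 0 < M ∧ |L| / M < ε / 2 := by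
    refine ⟨2 * (|L| + 1) / ε, by positivity, ?_⟩
    rw [div_div_eq_mul_div, div_lt_div_iff₀ (by positivity) two_pos]
    nlinarith [abs_nonneg L]
  have hfin : {k | ¬ M ≤ θ k}.Finite := hθ.eventually_ge_atTop M
  set s := hfin.toFinset with hs
  -- the truncations to the finite set `s` lie in a compact set
  have hK : IsCompact (finPoint s '' Set.univ.pi fun _ => Set.Icc 0 L) :=
    (isCompact_univ_pi fun _ => isCompact_Icc).image (continuous_finPoint s)
  obtain ⟨t, ht, hcover⟩ := Metric.totallyBounded_iff.1 hK.totallyBounded (ε / 2) (half_pos hε)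
  refine ⟨t, ht, ?_⟩
  rintro x ⟨hx, hxL⟩
  have hsum : Summable fun k => x k := by
    have := (lp.memℓp x).summable (by simp)
    simpa [Real.norm_of_nonneg (hx _)] using this
  have hdist : dist x (finPoint s x) ≤ |L| / M := by
    have h1 := lp.norm_sub_norm_compl_sub_single (p := 1) (by simp) x s
    simp only [ENNReal.toReal_one, Real.rpow_one] at h1
    have h2 : ‖x‖ = ∑' k, x k := by
      rw [lp.norm_eq_tsum_rpow (by simp)]
      simp [Real.norm_of_nonneg (hx _)]
    have h3 : ∑ k ∈ s, ‖x k‖ = ∑ k ∈ s, x k :=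
      Finset.sum_congr rfl fun k _ => Real.norm_of_nonneg (hx k)
    have h4 : ∑' k, x k ≤ ∑ k ∈ s, x k + |L| / M := by
      refine hsum.tsum_le_of_sum_le fun u => ?_
      have h5 : M * ∑ k ∈ u \ s, x k ≤ |L| := by
        rw [Finset.mul_sum]
        refine le_trans (Finset.sum_le_sum fun k hk => ?_) ((hxL (u \ s)).trans (le_abs_self L))
        refine mul_le_mul_of_nonneg_right ?_ (hx k)
        by_contra h
        exact (Finset.mem_sdiff.1 hk).2 (hfin.mem_toFinset.2 h)
      have h6 : ∑ k ∈ u \ s, x k ≤ |L| / M := by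
        rw [le_div_iff₀ hM0, mul_comm]
        exact h5
      have h7 : ∑ k ∈ u, x k ≤ ∑ k ∈ s, x k + ∑ k ∈ u \ s, x k := by
        rw [← Finset.sum_union Finset.disjoint_sdiff]
        exact Finset.sum_le_sum_of_subset_of_nonneg
          (by intro k hk; by_cases h : k ∈ s <;> simp [h, hk]) fun k _ _ => hx k
      linarith
    rw [dist_eq_norm]
    have h8 : ‖x - finPoint s x‖ = ‖x‖ - ∑ k ∈ s, x k := by
      rw [← h3, ← h1, finPoint]
      ring
    rw [h8, h2]
    linarith
  have hmem : finPoint s x ∈ finPoint s '' Set.univ.pi fun _ => Set.Icc 0 L := by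
    refine ⟨x, fun k _ => ⟨hx k, ?_⟩, rfl⟩
    have := hxL {k}
    rw [Finset.sum_singleton] at this
    nlinarith [hx k, hθ1 k]
  obtain ⟨y, hy, hy'⟩ := Set.mem_iUnion₂.1 (hcover hmem)
  refine Set.mem_iUnion₂.2 ⟨y, hy, ?_⟩
  rw [Metric.mem_ball] at hy' ⊢
  linarith [dist_triangle x (finPoint s x) y]

theorem exists_compact_gibbsMeasure_le (hd : 1 ≤ d) (hβ : 0 < β) (hb : 0 ≤ b) (hab : b < a)
    (m c : ℝ) :
    ∃ K : Set EllOne, IsCompact K ∧ ∀ᶠ N in atTop, gibbsMeasure d β a b m bc N Kᶜ ≤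
      ENNReal.ofReal (Real.exp (-(boxVolume d N * c))) := by
  obtain ⟨C, hC⟩ := exists_cycleWeight_le (d := d) hβ bc
  -- weights which tend to infinity so slowly that their exponential moments are bounded
  set θ : ℕ+ → ℝ := fun k => 1 + 1 / 4 * Real.log k with hθ
  have hk1 : ∀ k : ℕ+, (1 : ℝ) ≤ k := fun k => Nat.one_le_cast.2 k.pos
  have hθ1 : ∀ k, 1 ≤ θ k := fun k => by
    have := Real.log_nonneg (hk1 k)
    simp only [hθ]
    linarith
  have hθtop : Tendsto θ cofinite atTop := by
    have h1 : Tendsto (fun k : ℕ+ => (k : ℕ)) cofinite atTop := by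
      rw [← Nat.cofinite_eq_atTop]
      exact PNat.coe_injective.tendsto_cofinite
    have h2 := Real.tendsto_log_atTop.comp ((tendsto_natCast_atTop_atTop (R := ℝ)).comp h1)
    exact tendsto_atTop_add_const_left _ _ (h2.const_mul_atTop (by norm_num))
  have hexp : ∀ k : ℕ+, Real.exp (θ k) = Real.exp 1 * (k : ℝ) ^ (1 / 4 : ℝ) := fun k => by
    rw [hθ, Real.exp_add, Real.rpow_def_of_pos (zero_lt_one.trans_le (hk1 k)), mul_comm (1 / 4)]
  have hq : Summable fun k => C * (freeWeight d β 0 k * Real.exp (θ k)) := by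
    have h := (summable_freeWeight_mul_rpow (β := β) hd (r := 1 / 4) (by norm_num)).mul_left
      (C * Real.exp 1)
    refine h.congr fun k => ?_
    rw [hexp]
    ring
  set B := ∑' k, C * (freeWeight d β 0 k * Real.exp (θ k)) with hB
  set L := c - β * regEnergy a b m 0 0 + B with hL
  refine ⟨_, isCompact_weighted hθ1 hθtop L, ?_⟩
  filter_upwards [eventually_ge_atTop 1] with N hN
  have hV := boxVolume_pos (d := d) hN
  have hw0 := cycleWeight_nonneg (d := d) hβ 0 bc N
  have hle : ∀ k, cycleWeight d β 0 bc N k * Real.exp (θ k) ≤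
      C * (freeWeight d β 0 k * Real.exp (θ k)) := fun k => by
    rw [← mul_assoc]
    exact mul_le_mul_of_nonneg_right (hC N hN k) (Real.exp_pos _).le
  have hsum : Summable fun k => cycleWeight d β 0 bc N k * Real.exp (θ k) :=
    hq.of_nonneg_of_le (fun k => mul_nonneg (hw0 k) (Real.exp_pos _).le) hle
  have hBN : ∑' k, cycleWeight d β 0 bc N k * (Real.exp (θ k) - 1) ≤ B := by
    have h1 : Summable fun k => cycleWeight d β 0 bc N k * (Real.exp (θ k) - 1) := by
      simpa only [mul_sub, mul_one] using hsum.sub (summable_cycleWeight hd hβ bc hN)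
    refine h1.tsum_le_tsum (fun k => le_trans ?_ (hle k)) hq
    exact mul_le_mul_of_nonneg_left (by linarith) (hw0 k)
  refine (gibbsMeasure_le hd hβ hN (θ := θ) (c := β * regEnergy a b m 0 0 + L) hsum ?_).trans ?_
  · rintro _ hy hy' t f rfl
    have h1 := regEnergy_le_hylEnergy hb hab m hy' (finiteDensity_finPoint t f)
    refine add_le_add (mul_le_mul_of_nonneg_left h1 hβ.le) ?_
    by_contra h2
    refine hy ⟨hy', fun s => ?_⟩
    refine le_trans ?_ (not_le.1 h2).le
    rw [← (hasSum_mul_finPoint θ t f).tsum_eq]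
    exact (hasSum_mul_finPoint θ t f).summable.sum_le_tsum s fun k _ =>
      mul_nonneg (zero_le_one.trans (hθ1 k)) (hy' k)
  · refine ENNReal.ofReal_le_ofReal (Real.exp_le_exp.2 (neg_le_neg ?_))
    exact mul_le_mul_of_nonneg_left (by linarith) hV.le

end Upper

/-! ### Lower bounds: the probability of a single configuration -/

section Lower

variable {d : ℕ} {β a b : ℝ} {bc : BoundaryCondition}

/-- A crude form of Stirling's formula. -/
lemma log_factorial_le {n : ℕ} (hn : 1 ≤ n) :
    Real.log (n.factorial : ℝ) ≤ n * Real.log n - n + Real.log n + 1 := by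
  induction n, hn using Nat.le_induction with
  | base => simp
  | succ n hn ih =>
    have hn0 : (0 : ℝ) < n := by exact_mod_cast hn
    have h1 := Real.one_sub_inv_le_log_of_pos (show (0 : ℝ) < (n + 1) / n by positivity)
    rw [Real.log_div (by positivity) hn0.ne', inv_div] at h1
    have h2 : (1 : ℝ) - n / (n + 1) = 1 / (n + 1) := by
      field_simp
      ring
    rw [h2, div_le_iff₀ (by positivity)] at h1
    rw [Nat.factorial_succ]
    push_cast
    rw [Real.log_mul (by positivity) (by positivity)]
    nlinarith

/-- The Poisson probability of `⌊V t⌋` points for the mean `V w`, up to the factor `exp(-V w)`. -/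
lemma eventually_le_poisson_floor {V w : ℕ → ℝ} (hV : Tendsto V atTop atTop) {q : ℝ} (hq : 0 < q)
    (hw : Tendsto w atTop (𝓝 q)) {t : ℝ} (ht : 0 ≤ t) {η : ℝ} (hη : 0 < η) :
    ∀ᶠ N in atTop, Real.exp (-(V N * (rateTerm q t - q + η))) ≤
      (V N * w N) ^ ⌊t * V N⌋₊ / (⌊t * V N⌋₊.factorial : ℝ) := by
  rcases ht.eq_or_lt with rfl | ht
  · filter_upwards [hV.eventually_ge_atTop 0] with N hN
    simp only [rateTerm, zero_mul, zero_add, sub_self, Nat.floor_zero, pow_zero,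
      Nat.factorial_zero, Nat.cast_one, div_one]
    exact Real.exp_le_one_iff.2 (neg_nonpos.2 (by positivity))
  · have hn : Tendsto (fun N => (⌊t * V N⌋₊ : ℝ) / V N) atTop (𝓝 t) :=
      (tendsto_nat_floor_mul_div_atTop ht.le).comp hV
    have hfl : Tendsto (fun N => ⌊t * V N⌋₊) atTop atTop :=
      tendsto_nat_floor_atTop.comp (hV.const_mul_atTop ht)
    have hflR : Tendsto (fun N => (⌊t * V N⌋₊ : ℝ)) atTop atTop :=
      tendsto_natCast_atTop_atTop.comp hfl
    have hlog : Tendsto (fun N => Real.log (⌊t * V N⌋₊ : ℝ) / V N) atTop (𝓝 0) := by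
      have h := ((Real.isLittleO_log_id_atTop.tendsto_div_nhds_zero).comp hflR).mul hn
      rw [zero_mul] at h
      refine h.congr' ?_
      filter_upwards [hflR.eventually_gt_atTop 0] with N hN
      simp only [Function.comp, id]
      field_simp
    have hmain : Tendsto (fun N => (⌊t * V N⌋₊ : ℝ) / V N *
        (Real.log (w N / ((⌊t * V N⌋₊ : ℝ) / V N)) + 1) -
        (Real.log (⌊t * V N⌋₊ : ℝ) / V N + 1 / V N)) atTop
        (𝓝 (t * (Real.log (q / t) + 1) - (0 + 0))) := by
      refine (hn.mul ((((hw.div hn ht.ne').log ?_)).add_const 1)).sub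
        (hlog.add (tendsto_const_nhds.div_atTop hV))
      exact (div_pos hq ht).ne'
    have hlim : -(rateTerm q t - q + η) < t * (Real.log (q / t) + 1) - (0 + 0) := by
      rw [rateTerm, ← inv_div t q, Real.log_inv]
      linarith
    filter_upwards [hmain.eventually_const_lt hlim, hV.eventually_gt_atTop 0,
      hfl.eventually_ge_atTop 1, hw.eventually_const_lt hq] with N h1 h2 h3 h4
    set n := ⌊t * V N⌋₊ with hndef
    have hn0 : (0 : ℝ) < n := by exact_mod_cast h3
    have hfac : (0 : ℝ) < n.factorial := by exact_mod_cast n.factorial_pos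
    have hpow : 0 < (V N * w N) ^ n := pow_pos (mul_pos h2 h4) n
    rw [← Real.le_log_iff_exp_le (div_pos hpow hfac), Real.log_div hpow.ne' hfac.ne', Real.log_pow]
    have h5 := log_factorial_le h3
    have h6 : w N / (n / V N) = V N * w N / n := by
      field_simp
    rw [h6, Real.log_div (mul_pos h2 h4).ne' hn0.ne'] at h1
    have h7 := mul_le_mul_of_nonneg_left h1.le h2.le
    have h8 : V N * ((n : ℝ) / V N * (Real.log (V N * w N) - Real.log n + 1) -
        (Real.log n / V N + 1 / V N)) =
        n * (Real.log (V N * w N) - Real.log n + 1) - (Real.log n + 1) := by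
      field_simp
    rw [h8] at h7
    linarith

lemma hasSum_rateTerm_finPoint (hd : 1 ≤ d) (s : Finset ℕ+) (f : ℕ+ → ℝ) :
    HasSum (fun k => rateTerm (freeWeight d β 0 k) (finPoint s f k))
      (∑' k, freeWeight d β 0 k +
        ∑ k ∈ s, (rateTerm (freeWeight d β 0 k) (f k) - freeWeight d β 0 k)) := by
  have h := (summable_freeWeight (β := β) hd).hasSum.add (hasSum_comp_finPoint s f
    (φ := fun k t => rateTerm (freeWeight d β 0 k) t - freeWeight d β 0 k) (by simp [rateTerm]))
  simpa using h

lemma idealRate_finPoint (hd : 1 ≤ d) (hβ : 0 < β) {s : Finset ℕ+} {f : ℕ+ → ℝ}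
    (hf : ∀ k, 0 ≤ f k) :
    idealRate d β 0 (finPoint s f) = ENNReal.ofReal (∑' k, freeWeight d β 0 k +
        ∑ k ∈ s, (rateTerm (freeWeight d β 0 k) (f k) - freeWeight d β 0 k)) := by
  have hnn := isNonneg_finPoint (s := s) fun k _ => hf k
  have h := hasSum_rateTerm_finPoint (β := β) hd s f
  rw [idealRate_of_isNonneg hnn, ← h.tsum_eq, ENNReal.ofReal_tsum_of_nonneg
    (fun k => rateTerm_nonneg (freeWeight_pos hβ 0 k) (hnn k)) h.summable]

lemma tendsto_tsum_cycleWeight (hd : 1 ≤ d) (hβ : 0 < β) :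
    Tendsto (fun N => ∑' k, cycleWeight d β 0 bc N k) atTop (𝓝 (∑' k, freeWeight d β 0 k)) := by
  obtain ⟨C, hC⟩ := exists_cycleWeight_le (d := d) hβ bc
  refine tendsto_tsum_of_dominated_convergence ((summable_freeWeight (β := β) hd).mul_left C)
    (tendsto_cycleWeight hβ bc) ?_
  filter_upwards [eventually_ge_atTop 1] with N hN k
  rw [Real.norm_of_nonneg (cycleWeight_nonneg hβ 0 bc N k)]
  exact hC N hN k

/-- The lower bound near a finitely supported point `x`, from the probability of the single
configuration with `⌊|Λ_N| xₖ⌋` cycles of each length `k`. -/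
theorem eventually_le_gibbsMeasure_finPoint (hd : 1 ≤ d) (hβ : 0 < β) (m : ℝ) {s : Finset ℕ+}
    {f : ℕ+ → ℝ} (hf : ∀ k, 0 ≤ f k) {U : Set EllOne} (hU : U ∈ 𝓝 (finPoint s f)) {c : ℝ}
    (hc : β * hylEnergy a b m (finPoint s f) + (∑' k, freeWeight d β 0 k +
      ∑ k ∈ s, (rateTerm (freeWeight d β 0 k) (f k) - freeWeight d β 0 k)) < c) :
    ∀ᶠ N in atTop, ENNReal.ofReal (Real.exp (-(boxVolume d N * c))) ≤
      gibbsMeasure d β a b m bc N U := by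
  classical
  have hVt := tendsto_boxVolume hd
  set E := hylEnergy a b m (finPoint s f) with hE
  set R := ∑ k ∈ s, (rateTerm (freeWeight d β 0 k) (f k) - freeWeight d β 0 k) with hR
  set Q := ∑' k, freeWeight d β 0 k with hQ
  obtain ⟨η, hη, hηc⟩ : ∃ η, 0 < η ∧ β * (E + η) + (Q + η) + (R + s.card * η) ≤ c := by
    refine ⟨(c - (β * E + (Q + R))) / (β + 1 + s.card), ?_, le_of_eq ?_⟩
    · exact div_pos (by linarith) (by positivity)
    · field_simp
      ring
  set n : ℕ → ℕ+ →₀ ℕ := fun N =>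
    Finsupp.onFinset s (fun k => if k ∈ s then ⌊f k * boxVolume d N⌋₊ else 0)
      (fun k hk => by by_contra h; simp [h] at hk) with hn
  have hpt : ∀ N, empiricalPoint (boxVolume d N) (n N) =
      finPoint s fun k => (⌊f k * boxVolume d N⌋₊ : ℝ) / boxVolume d N := by
    intro N
    refine lp.ext (funext fun k => ?_)
    rw [empiricalPoint_apply, finPoint_apply]
    by_cases hk : k ∈ s <;> simp [hn, hk]
  have hfl : ∀ k, Tendsto (fun N => (⌊f k * boxVolume d N⌋₊ : ℝ) / boxVolume d N) atTop
      (𝓝 (f k)) := fun k => (tendsto_nat_floor_mul_div_atTop (hf k)).comp hVt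
  have hconv : Tendsto (fun N => empiricalPoint (boxVolume d N) (n N)) atTop
      (𝓝 (finPoint s f)) := by
    simp only [hpt]
    exact ((continuous_finPoint s).tendsto f).comp (tendsto_pi_nhds.2 hfl)
  have hEconv : Tendsto (fun N => hylEnergy a b m (empiricalPoint (boxVolume d N) (n N))) atTop
      (𝓝 E) := by
    simp only [hpt, hylEnergy_finPoint, hE]
    have h1 : Tendsto (fun N => ∑ k ∈ s, (k : ℝ) *
        ((⌊f k * boxVolume d N⌋₊ : ℝ) / boxVolume d N)) atTop (𝓝 (∑ k ∈ s, (k : ℝ) * f k)) :=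
      tendsto_finsetSum _ fun k _ => (hfl k).const_mul _
    have h2 : Tendsto (fun N => ∑ k ∈ s, (k : ℝ) ^ 2 *
        ((⌊f k * boxVolume d N⌋₊ : ℝ) / boxVolume d N) ^ 2) atTop
        (𝓝 (∑ k ∈ s, (k : ℝ) ^ 2 * f k ^ 2)) :=
      tendsto_finsetSum _ fun k _ => ((hfl k).pow 2).const_mul _
    exact ((h1.const_mul _).add ((h1.pow 2).const_mul _)).sub (h2.const_mul _)
  have hpoi : ∀ᶠ N in atTop, ∀ k ∈ s, Real.exp (-(boxVolume d N *
      (rateTerm (freeWeight d β 0 k) (f k) - freeWeight d β 0 k + η))) ≤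
      (boxVolume d N * cycleWeight d β 0 bc N k) ^ ⌊f k * boxVolume d N⌋₊ /
        (⌊f k * boxVolume d N⌋₊.factorial : ℝ) :=
    (Finset.eventually_all s).2 fun k _ => eventually_le_poisson_floor hVt
      (freeWeight_pos hβ 0 k) (tendsto_cycleWeight hβ bc k) (hf k) hη
  filter_upwards [eventually_ge_atTop 1, hconv.eventually hU, hpoi,
    hEconv.eventually_lt_const (lt_add_of_pos_right E hη),
    (tendsto_tsum_cycleWeight (bc := bc) hd hβ).eventually_lt_const
      (lt_add_of_pos_right Q hη)] with N hN h1 h2 h3 h4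
  have hV := boxVolume_pos (d := d) hN
  refine le_trans (ENNReal.ofReal_le_ofReal ?_) (le_gibbsMeasure m h1)
  have hprod : Real.exp (-(boxVolume d N * (R + s.card * η))) ≤
      (n N).prod fun k j =>
        (boxVolume d N * cycleWeight d β 0 bc N k) ^ j / (j.factorial : ℝ) := by
    have e1 : ((n N).prod fun k j =>
        (boxVolume d N * cycleWeight d β 0 bc N k) ^ j / (j.factorial : ℝ)) =
        ∏ k ∈ s, (boxVolume d N * cycleWeight d β 0 bc N k) ^ ⌊f k * boxVolume d N⌋₊ /
          (⌊f k * boxVolume d N⌋₊.factorial : ℝ) := by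
      rw [hn, Finsupp.onFinset_prod _ fun k => by simp]
      exact Finset.prod_congr rfl fun k hk => by simp [hk]
    have e2 : -(boxVolume d N * (R + s.card * η)) = ∑ k ∈ s, -(boxVolume d N *
        (rateTerm (freeWeight d β 0 k) (f k) - freeWeight d β 0 k + η)) := by
      rw [Finset.sum_neg_distrib, ← Finset.mul_sum, Finset.sum_add_distrib, Finset.sum_const,
        nsmul_eq_mul]
    rw [e1, e2, Real.exp_sum]
    exact Finset.prod_le_prod (fun k _ => (Real.exp_pos _).le) h2
  have hprod0 := (Real.exp_pos _).le.trans hprod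
  rw [gibbsWeight, cycleCountWeight, poissonWeight, tsum_mul_left]
  calc Real.exp (-(boxVolume d N * c))
      ≤ Real.exp (-(boxVolume d N * (Q + η))) * Real.exp (-(boxVolume d N * (R + s.card * η))) *
          Real.exp (-(β * boxVolume d N * (E + η))) := by
        rw [← Real.exp_add, ← Real.exp_add, Real.exp_le_exp]
        have := mul_le_mul_of_nonneg_left hηc hV.le
        linarith
    _ ≤ _ := by gcongr

theorem eventually_le_gibbsMeasure (hd : 1 ≤ d) (hβ : 0 < β) (hb : 0 ≤ b) (hab : b < a) (m : ℝ)
    (x : EllOne) (c : ℝ) (hc : regFunctional d β a b m x < (c : EReal)) (U : Set EllOne)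
    (hU : U ∈ 𝓝 x) :
    ∀ᶠ N in atTop, ENNReal.ofReal (Real.exp (-(boxVolume d N * c))) ≤
      gibbsMeasure d β a b m bc N U := by
  have hIbot : (idealRate d β 0 x : EReal) ≠ ⊥ := EReal.coe_ennreal_ne_bot _
  have hH : regHamiltonian a b m x ≠ ⊤ := by
    intro h
    rw [regFunctional, h, EReal.coe_mul_top_of_pos hβ, EReal.top_add_of_ne_bot hIbot] at hc
    exact not_top_lt hc
  have hx : IsNonneg x := by
    by_contra h
    exact hH (regHamiltonian_of_not_isNonneg a b m h)
  have hD : FiniteDensity x := by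
    by_contra h
    exact hH (regHamiltonian_of_not_finiteDensity hb hab m h)
  rw [regFunctional, regHamiltonian_eq hb hab m hx hD, ← EReal.coe_mul] at hc
  have hI : idealRate d β 0 x ≠ ⊤ := by
    intro h
    rw [h, EReal.coe_ennreal_top, EReal.add_top_of_ne_bot (EReal.coe_ne_bot _)] at hc
    exact not_top_lt hc
  set i := (idealRate d β 0 x).toReal with hi
  have hiI : idealRate d β 0 x = ENNReal.ofReal i := (ENNReal.ofReal_toReal hI).symm
  have hi0 : 0 ≤ i := ENNReal.toReal_nonneg
  rw [hiI, EReal.coe_ennreal_ofReal, max_eq_left hi0, ← EReal.coe_add, EReal.coe_lt_coe_iff,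
    regEnergy_eq hab] at hc
  set δ := max (m - a * density x) 0 / (a - b) with hδdef
  have hδ : 0 ≤ δ := div_nonneg (le_max_right _ _) (sub_pos.2 hab).le
  have hElim := (tendsto_hylEnergy_condensed a b m hx hD δ).const_mul β
  obtain ⟨r, hr, hrle⟩ := exists_idealRate_condensed_le (β := β) hd hβ hx hδ
  set E₀ := -m * (density x + δ) + a / 2 * (density x + δ) ^ 2 -
    b / 2 * ((∑' k : ℕ+, (k : ℝ) ^ 2 * x k ^ 2) + δ ^ 2) with hE₀
  set ε := (c - (β * E₀ + i)) / 2 with hε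
  have hε0 : 0 < ε := by
    rw [hε]
    linarith
  obtain ⟨l, h1, h2, h3⟩ := (((tendsto_condensed x δ).eventually (eventually_mem_nhds_iff.2 hU)).and
    ((hElim.eventually_lt_const (lt_add_of_pos_right _ hε0)).and
      (hr.eventually_lt_const (ENNReal.ofReal_pos.2 hε0)))).exists
  refine eventually_le_gibbsMeasure_finPoint hd hβ m (update_nonneg hx hδ l) h1 ?_
  have h4 := (hrle l).trans (add_le_add le_rfl h3.le)
  rw [hiI, ← ENNReal.ofReal_add hi0 hε0.le, condensed,
    idealRate_finPoint hd hβ (update_nonneg hx hδ l),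
    ENNReal.ofReal_le_ofReal_iff (by linarith)] at h4
  have h5 : β * hylEnergy a b m (condensed x δ l) < β * E₀ + ε := h2
  rw [condensed] at h5
  linarith

end Lower

/-! ### The large deviation principle for the HYL model -/

lemma regFunctional_bddBelow_and_proper {d : ℕ} (hd : 1 ≤ d) {β a b : ℝ} (hβ : 0 < β)
    (hb : 0 ≤ b) (hab : b < a) (m : ℝ) :
    (∃ r : ℝ, ∀ x, (r : EReal) ≤ regFunctional d β a b m x) ∧
      ∃ x, regFunctional d β a b m x < ⊤ := by
  constructor
  · refine ⟨β * regEnergy a b m 0 0, fun x => ?_⟩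
    rw [EReal.coe_mul, regFunctional, ← add_zero ((β : EReal) * (regEnergy a b m 0 0 : EReal))]
    exact add_le_add (mul_le_mul_of_nonneg_left (regHamiltonian_ge a b m x)
      (by exact_mod_cast hβ.le)) (EReal.coe_ennreal_nonneg _)
  · refine ⟨finPoint ∅ 0, ?_⟩
    rw [regFunctional, regHamiltonian_eq hb hab m (isNonneg_finPoint (by simp))
      (finiteDensity_finPoint _ _), idealRate_finPoint hd hβ (f := 0) (fun _ => le_refl 0),
      EReal.coe_ennreal_ofReal, ← EReal.coe_mul, ← EReal.coe_add]
    exact EReal.coe_lt_top _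

lemma hylFunctional_eq {d : ℕ} {β a b : ℝ} (hb : 0 ≤ b) (hab : b < a) (m : ℝ) :
    hylFunctional d β a b m = regFunctional d β a b m := by
  funext x
  rw [hylFunctional, lscRegularisation_hylHamiltonian hb hab, regFunctional]

theorem satisfiesLDP_hylMeasure {d : ℕ} (hd : 1 ≤ d) {β a b : ℝ} (hβ : 0 < β) (hb : 0 ≤ b)
    (hab : b < a) {α : ℝ} (hα : α ≤ 0) (μ : ℝ) (bc : BoundaryCondition) :
    SatisfiesLDP (hylMeasure d β a b μ α bc) (boxVolume d) (hylRate d β a b μ α) := by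
  have h := regFunctional_bddBelow_and_proper hd hβ hb hab (μ + α)
  have hldp := satisfiesLDP_of_local_bounds (ρ := gibbsMeasure d β a b (μ + α) bc)
    (ν := hylMeasure d β a b μ α bc) (Φ := regFunctional d β a b (μ + α)) (tendsto_boxVolume hd)
    ((eventually_ge_atTop 1).mono fun N hN A hA => hylMeasure_apply hd hβ hα hN μ hA)
    (exists_nhds_gibbsMeasure_le hd hβ hb hab (μ + α))
    (exists_compact_gibbsMeasure_le hd hβ hb hab (μ + α))
    (eventually_le_gibbsMeasure hd hβ hb hab (μ + α)) h.1 h.2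
  have hrate : hylRate d β a b μ α = fun x =>
      regFunctional d β a b (μ + α) x - ⨅ y, regFunctional d β a b (μ + α) y := by
    funext x
    rw [hylRate, hylFunctional_eq hb hab]
  rw [hrate]
  exact hldp

lemma regEnergy_eq_cases {a b : ℝ} (hb : 0 ≤ b) (hab : b < a) (m D S : ℝ) :
    regEnergy a b m D S = -(b / 2) * S +
      (if m / a ≤ D then -m * D + a / 2 * D ^ 2
        else -(b / (a - b)) * (-m * D + a / 2 * D ^ 2) - m ^ 2 / (2 * (a - b))) := by
  have ha : 0 < a := hb.trans_lt hab
  have hab' : a - b ≠ 0 := (sub_pos.2 hab).ne'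
  unfold regEnergy
  split_ifs with h
  · rw [div_le_iff₀ ha] at h
    rw [max_eq_right (by linarith)]
    ring
  · rw [not_le, lt_div_iff₀ ha] at h
    rw [max_eq_left (by linarith)]
    field_simp
    ring

theorem theorem1p5 (d : ℕ) (hd : 1 ≤ d) (β : ℝ) (hβ : 0 < β) (a b : ℝ) (hb : 0 ≤ b) (hab : b < a)
    (α : ℝ) (hα : α ≤ 0) (μ : ℝ) (bc : BoundaryCondition) :
    (∀ N : ℕ, 1 ≤ N →
      IsProbabilityMeasure (referenceMeasure d β α bc N) ∧
      IsProbabilityMeasure (hylMeasure d β a b μ α bc N)) ∧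
    SatisfiesLDP (hylMeasure d β a b μ α bc) (boxVolume d) (hylRate d β a b μ α) ∧
    (∀ (m : ℝ) (x : EllOne), IsNonneg x → FiniteDensity x →
      lscRegularisation (hylHamiltonian a b m) x =
        ((hylEnergy a b m x - 1 / (2 * (a - b)) * max (m - a * density x) 0 ^ 2 : ℝ) : EReal) ∧
      lscRegularisation (hylHamiltonian a b m) x =
        ((-(b / 2) * ∑' k : ℕ+, (k : ℝ) ^ 2 * x k ^ 2 +
          (if m / a ≤ density x then -m * density x + a / 2 * density x ^ 2
            else -(b / (a - b)) * (-m * density x + a / 2 * density x ^ 2)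
              - m ^ 2 / (2 * (a - b))) : ℝ) : EReal)) ∧
    (∀ (m : ℝ) (x : EllOne), ¬ (IsNonneg x ∧ FiniteDensity x) →
      lscRegularisation (hylHamiltonian a b m) x = ⊤) := by
  refine ⟨fun N hN => ⟨isProbabilityMeasure_referenceMeasure hd hβ hα hN,
    isProbabilityMeasure_hylMeasure hd hβ hb hab hα hN μ⟩,
    satisfiesLDP_hylMeasure hd hβ hb hab hα μ bc, fun m x hx hD => ?_, fun m x hx => ?_⟩
  · rw [lscRegularisation_hylHamiltonian hb hab, regHamiltonian_eq hb hab m hx hD]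
    exact ⟨rfl, congrArg _ (regEnergy_eq_cases hb hab m _ _)⟩
  · rw [lscRegularisation_hylHamiltonian hb hab]
    by_cases hn : IsNonneg x
    · exact regHamiltonian_of_not_finiteDensity hb hab m fun hD => hx ⟨hn, hD⟩
    · exact regHamiltonian_of_not_isNonneg a b m hn
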